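/- Let $s>2$, let $\mathcal{Q}$ be a finite generalised quadrangle of order $(s,s^2)$, and let $\mathcal{Q}'$ be a generalised subquadrangle of $\mathcal{Q}$ of order $(s,s)$. For a point $X$ of $\mathcal{Q}$ not in $\mathcal{Q}'$, let $\mathcal{O}_X$ be the set of points of $\mathcal{Q}'$ collinear with $X$. Assume that $\mathcal{Q}'$ is doubly subtended in $\mathcal{Q}$, i.e. for every point $X$ of $\mathcal{Q}\setminus\mathcal{Q}'$ there is exactly one point $X'\neq X$ of $\mathcal{Q}\setminus\mathcal{Q}'$ with $\mathcal{O}_{X'}=\mathcal{O}_X$. Let $\Omega$ be the set of points of $\mathcal{Q}\setminus\mathcal{Q}'$ and define relations on $\Omega$ by: $R_0$ is the identity; $(X,Y)\in R_1$ iff $X,Y$ are not collinear and $|\mathcal{O}_X\cap\mathcal{O}_Y|=1$; $(X,Y)\in R_2$ iff $X,Y$ are not collinear and $|\mathcal{O}_X\cap\mathcal{O}_Y|=s+1$; $(X,Y)\in R_3$ iff $X\ne Y$ and $X,Y$ are collinear; $(X,Y)\in R_4$ iff $X\neq Y$ and $\mathcal{O}_X=\mathcal{O}_Y$. Then $(\Omega,\{R_0,\dots,R_4\})$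 is a (symmetric) association scheme, the Penttila–Williford scheme, and it has a cometric ordering, i.e. an ordering $E_0=\frac{1}{|\Omega|}J,E_1,\dots,E_4$ of its minimal idempotents for which the Krein parameters $q_{ij}^h$, defined by $E_i\circ E_j=\frac1{|\Omega|}\sum_h q_{ij}^hE_h$ (with $\circ$ the entrywise product), satisfy $q_{ij}^h=0$ whenever $i+j<h$ or $h<|i-j|$, and $q_{ij}^{i+j}\ne0$ whenever $i+j\le 4$. Moreover, let $E_0,\dots,E_4$ be any cometric ordering, let $V_i$ be the image of $E_i$ in $\mathbb{R}^\Omega$, and let $\emptyset\neq\theta\subsetneq\Omega$ have characteristic vector $\chi_\theta$. If $\theta$ is an intriguing set of type $1$ ($\chi_\theta\in V_0\perp V_1$), or an intriguing set of type $3$ ($\chi_\theta\in V_0\perp V_3$), or a $\{2,4\}$-design ($\chi_\theta E_2=\chi_\theta E_4=0$), then $|\theta|=\tfrac12|\Omega|$. -/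

import Mathlib

open scoped Matrix

/-! ### Generalised quadrangles, given by an incidence relation between points and lines -/

/-- Two points are collinear if some line is incident with both (a point on some line is
collinear with itself). -/
def Collin {P L : Type*} (I : P → L → Prop) (p q : P) : Prop :=
  ∃ l, I p l ∧ I q l

/-- The incidence structure `I` is a generalised quadrangle of order `(s, t)`. A cardinality
`n + 1` for `Set.ncard` includes the finiteness of the set. -/
structure IsGQ {P L : Type*} (I : P → L → Prop) (s t : ℕ) : Prop where
  one_le_s : 1 ≤ s
  one_le_t : 1 ≤ t
  nonempty : Nonempty P
  line_unique : ∀ p q : P, ∀ l m : L, p ≠ q → I p l → I q l → I p m → I q m → l = m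
  card_line : ∀ l : L, {p | I p l}.ncard = s + 1
  card_point : ∀ p : P, {l | I p l}.ncard = t + 1
  proj : ∀ (p : P) (l : L), ¬ I p l → ∃! q : P, I q l ∧ Collin I p q

/-- The points `P'` and lines `L'`, with the incidence inherited from `I`, form a generalised
subquadrangle of order `(s, t')`. -/
def IsSubGQ {P L : Type*} (I : P → L → Prop) (P' : Set P) (L' : Set L) (s t' : ℕ) : Prop :=
  IsGQ (fun (p : P') (l : L') => I p l) s t'

/-- The set `X^⊥ ∩ P'` subtended by the point `X`. -/
def subtended {P L : Type*} (I : P → L → Prop) (P' : Set P) (X : P) : Set P :=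
  {p | p ∈ P' ∧ Collin I X p}

/-- Every subtended ovoid of `P'` is subtended by exactly two points outside `P'`. -/
def IsDoublySubtended {P L : Type*} (I : P → L → Prop) (P' : Set P) : Prop :=
  ∀ X, X ∉ P' → ∃! Y, Y ∉ P' ∧ Y ≠ X ∧ subtended I P' Y = subtended I P' X

/-- The five Penttila–Williford relations on the points outside `P'`. -/
def pwRel {P L : Type*} (I : P → L → Prop) (P' : Set P) (s : ℕ) :
    Fin 5 → {p : P // p ∉ P'} → {p : P // p ∉ P'} → Prop :=
  ![fun X Y => X = Y,
    fun X Y => ¬ Collin I X.1 Y.1 ∧ (subtended I P' X ∩ subtended I P' Y).ncard = 1,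
    fun X Y => ¬ Collin I X.1 Y.1 ∧ (subtended I P' X ∩ subtended I P' Y).ncard = s + 1,
    fun X Y => X ≠ Y ∧ Collin I X.1 Y.1,
    fun X Y => X ≠ Y ∧ subtended I P' X = subtended I P' Y]

/-! ### Association schemes -/

/-- The relations `R 0, …, R d` form a (symmetric) `d`-class association scheme on `V`. -/
structure IsAssociationScheme {V : Type*} {d : ℕ} (R : Fin (d + 1) → V → V → Prop) : Prop where
  diag : ∀ x y, R 0 x y ↔ x = y
  partition : ∀ x y, ∃! i, R i x y
  nonempty : ∀ i, ∃ x y, R i x y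
  symm : ∀ i x y, R i x y → R i y x
  inter : ∀ i j h, ∃ p : ℕ, ∀ x y, R h x y → {z | R i x z ∧ R j z y}.ncard = p

open Classical in
/-- The adjacency matrix of a relation. -/
noncomputable def relMatrix {V : Type*} (r : V → V → Prop) : Matrix V V ℝ :=
  Matrix.of fun x y => if r x y then 1 else 0

/-- `E 0, …, E d` is an ordering of the minimal idempotents of the algebra spanned by the
adjacency matrices of the `R i`, in which `E 0` is `|V|⁻¹` times the all-ones matrix: these are
`d + 1` nonzero, pairwise orthogonal idempotents with sum `1` in an algebra of dimension
`d + 1`. -/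
structure IsIdempotentOrdering {V : Type*} [Fintype V] [DecidableEq V] {d : ℕ}
    (R : Fin (d + 1) → V → V → Prop) (E : Fin (d + 1) → Matrix V V ℝ) : Prop where
  mem_span : ∀ i, E i ∈ Submodule.span ℝ (Set.range fun j => relMatrix (R j))
  ne_zero : ∀ i, E i ≠ 0
  mul_self : ∀ i, E i * E i = E i
  mul_of_ne : ∀ i j, i ≠ j → E i * E j = 0
  sum_eq : ∑ i, E i = 1
  zero_eq : E 0 = Matrix.of fun _ _ => (Fintype.card V : ℝ)⁻¹

/-- `q i j h` are the Krein parameters `q_{ij}^h` for the ordering `E`: the coefficients in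
`E_i ∘ E_j = |V|⁻¹ ∑_h q_{ij}^h E_h`, with `∘` the entrywise product. -/
def IsKrein {V : Type*} [Fintype V] {d : ℕ} (E : Fin (d + 1) → Matrix V V ℝ)
    (q : Fin (d + 1) → Fin (d + 1) → Fin (d + 1) → ℝ) : Prop :=
  ∀ i j, E i ⊙ E j = (Fintype.card V : ℝ)⁻¹ • ∑ h, q i j h • E h

/-- The scheme `R` is cometric (`Q`-polynomial) with respect to the ordering `E` of its minimal
idempotents. The condition `h < |i - j|` is written without subtraction. -/
def IsCometricOrdering {V : Type*} [Fintype V] [DecidableEq V] {d : ℕ}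
    (R : Fin (d + 1) → V → V → Prop) (E : Fin (d + 1) → Matrix V V ℝ) : Prop :=
  IsIdempotentOrdering R E ∧ ∃ q, IsKrein E q ∧
    (∀ i j h : Fin (d + 1),
      ((i : ℕ) + j < h ∨ (h : ℕ) + j < i ∨ (h : ℕ) + i < j) → q i j h = 0) ∧
    (∀ i j h : Fin (d + 1), (h : ℕ) = i + j → q i j h ≠ 0)

/-- The characteristic vector of a set of vertices. -/
noncomputable def charVec {V : Type*} (θ : Set V) : V → ℝ :=
  θ.indicator 1

/-- The simultaneous eigenspace `V_i`, the image of the projection `E i`. -/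
noncomputable def eigSpace {V : Type*} [Fintype V] {d : ℕ}
    (E : Fin (d + 1) → Matrix V V ℝ) (i : Fin (d + 1)) : Submodule ℝ (V → ℝ) :=
  LinearMap.range (E i).mulVecLin

/-- Intriguing sets of type `h`: the characteristic vector lies in `V_0 ⊥ V_h`. -/
def IsIntriguing {V : Type*} [Fintype V] {d : ℕ}
    (E : Fin (d + 1) → Matrix V V ℝ) (h : Fin (d + 1)) (θ : Set V) : Prop :=
  charVec θ ∈ eigSpace E 0 ⊔ eigSpace E h

/-- Delsarte `T`-designs. -/
def IsTDesign {V : Type*} [Fintype V] {d : ℕ}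
    (E : Fin (d + 1) → Matrix V V ℝ) (T : Set (Fin (d + 1))) (θ : Set V) : Prop :=
  ∀ i ∈ T, charVec θ ᵥ* E i = 0

/-! ### Adjacency matrices and counting. -/

section RelMatrix

variable {V : Type*}

/-! Write `X'` for the antipode of `X`, the other external point subtending the same ovoid, and
`A_r` for the adjacency matrices. Every line meets the subquadrangle (`IsSubGQ.exists_mem`), so
subtended sets have `s ^ 2 + 1` points and the ovoid of `X` is all of `{X, X'}^⊥`. If `Y` is
collinear with neither `X` nor `X'`, then `X, X', Y` is a triad, and its `s + 1` centres
(`IsGQ.ncard_centres`) are exactly the common points of the two ovoids. Hence `R_1` means "collinear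
with `X'`", and the five relations partition the pairs.

The algebra comes from two matrices. `A_4` is the permutation matrix of the antipodal map and
exchanges `R_r` with `R_{4-r}`. `A_3 ^ 2` is found by taking common neighbours in the whole
quadrangle and discarding those in the subquadrangle. Since `A_1 = A_3 A_4` and `A_2` is the
complement of the rest, this verifies explicit eigenmatrices (`hasEigenmatrices_pwRel`). These yield
the intersection numbers, the idempotents and the Krein parameters, so the cometric property becomes
a finite check of polynomials in `s`.

For the halving statement, let `A_4` act on `E_i` by `c_i = ±1`. Entrywise products multiply these
signs, and `q_{ij}^{i+j} ≠ 0` then forces `c_{i+j} = c_i c_j`, so the signs are `1, -1, 1, -1, 1` in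
any cometric ordering (`IsCometricOrdering.exists_signs`). Each of the three assumptions on `θ`
leaves only `E_0` and odd components in its characteristic vector. Adding the antipodal image
cancels the odd ones, so `χ(X) + χ(X')` is constant. As `θ` is neither empty nor everything, the
constant is `1`: `θ` contains exactly one point of each antipodal pair. -/

lemma relMatrix_of_rel {r : V → V → Prop} {x y : V} (h : r x y) : relMatrix r x y = 1 := by
  simp [relMatrix, h]

lemma relMatrix_of_not_rel {r : V → V → Prop} {x y : V} (h : ¬ r x y) :
    relMatrix r x y = 0 := by
  simp [relMatrix, h]

lemma relMatrix_mul_apply [Fintype V] (r r' : V → V → Prop) (x y : V) :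
    (relMatrix r * relMatrix r') x y = ({z | r x z ∧ r' z y}.ncard : ℝ) := by
  classical
  rw [Set.ncard_eq_toFinset_card', Matrix.mul_apply, Finset.card_eq_sum_ones, Nat.cast_sum]
  simp only [relMatrix, Matrix.of_apply, Set.toFinset_ofPred, Finset.sum_filter]
  refine Finset.sum_congr rfl fun z _ => ?_
  by_cases h1 : r x z <;> by_cases h2 : r' z y <;> simp [h1, h2]

lemma sum_relMatrix [Fintype V] (r : V → V → Prop) (x : V) :
    ∑ y, relMatrix r x y = ({y | r x y}.ncard : ℝ) := by
  classical
  rw [Set.ncard_eq_toFinset_card']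
  simp [relMatrix]

lemma sum_indicator_one [Fintype V] (S : Set V) :
    ∑ y, S.indicator (1 : V → ℝ) y = (S.ncard : ℝ) := by
  classical
  rw [Set.ncard_eq_toFinset_card', Finset.card_eq_sum_ones, Nat.cast_sum,
    ← Finset.sum_indicator_subset _ (Finset.subset_univ S.toFinset)]
  refine Finset.sum_congr rfl fun y _ => ?_
  by_cases hy : y ∈ S <;> simp [hy]

end RelMatrix

/-! ### Counting in generalised quadrangles, up to the centres of triads. -/

section Collinearity

variable {P L : Type*} {I : P → L → Prop} {s t : ℕ}

lemma Collin.symm {p q : P} (h : Collin I p q) : Collin I q p :=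
  let ⟨l, hp, hq⟩ := h
  ⟨l, hq, hp⟩

namespace IsGQ

lemma finite_lines (h : IsGQ I s t) (p : P) : {l | I p l}.Finite :=
  Set.finite_of_ncard_ne_zero (by rw [h.card_point]; omega)

lemma finite_points (h : IsGQ I s t) (l : L) : {p | I p l}.Finite :=
  Set.finite_of_ncard_ne_zero (by rw [h.card_line]; omega)

lemma exists_line (h : IsGQ I s t) (p : P) : ∃ l, I p l :=
  Set.nonempty_of_ncard_ne_zero (s := {l | I p l}) (by rw [h.card_point]; omega)

lemma collin_refl (h : IsGQ I s t) (p : P) : Collin I p p :=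
  let ⟨l, hl⟩ := h.exists_line p
  ⟨l, hl, hl⟩

/-- A generalised quadrangle has no triangles. -/
lemma incident_of_collin (h : IsGQ I s t) {p q r : P} {l : L} (hpq : p ≠ q) (hp : I p l)
    (hq : I q l) (hrp : Collin I r p) (hrq : Collin I r q) : I r l := by
  by_contra hr
  exact hpq ((h.proj r l hr).unique ⟨hp, hrp⟩ ⟨hq, hrq⟩)

lemma eq_of_incident (h : IsGQ I s t) {p q : P} {l m : L} (hlm : l ≠ m) (hpl : I p l)
    (hql : I q l) (hpm : I p m) (hqm : I q m) : p = q := by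
  by_contra hpq
  exact hlm (h.line_unique p q l m hpq hpl hql hpm hqm)

lemma ncard_collin [Finite P] (h : IsGQ I s t) (p : P) :
    {q | Collin I p q}.ncard = 1 + s * (t + 1) := by
  classical
  have hfin := h.finite_lines p
  have hset : {q | Collin I p q} = insert p (⋃ l ∈ {l | I p l}, ({q | I q l} \ {p})) := by
    ext q
    simp only [Set.mem_ofPred_eq, Set.mem_insert_iff, Set.mem_iUnion, Set.mem_sdiff,
      Set.mem_singleton_iff, exists_prop]
    constructor
    · rintro ⟨l, hp, hq⟩
      by_cases hqp : q = p
      · exact Or.inl hqp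
      · exact Or.inr ⟨l, hp, hq, hqp⟩
    · rintro (rfl | ⟨l, hp, hq, -⟩)
      · exact h.collin_refl q
      · exact ⟨l, hp, hq⟩
  have hdisj : {l | I p l}.PairwiseDisjoint fun l => ({q | I q l} \ {p} : Set P) := by
    intro l hl m hm hlm
    rw [Function.onFun, Set.disjoint_left]
    rintro q ⟨hql, hqp⟩ ⟨hqm, -⟩
    exact hqp (h.eq_of_incident hlm hql hl hqm hm)
  rw [hset, Set.ncard_insert_of_notMem (by simp),
    hfin.ncard_biUnion (fun _ _ => Set.toFinite _) hdisj]
  have hcard : ∀ l ∈ {l | I p l}, ({q | I q l} \ {p} : Set P).ncard = s := fun l hl => by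
    rw [Set.ncard_sdiff_singleton_of_mem (s := {q | I q l}) hl, h.card_line]; omega
  rw [finsum_mem_congr rfl hcard, finsum_mem_eq_finite_toFinset_sum _ hfin, Finset.sum_const,
    ← Set.ncard_eq_toFinset_card _ hfin, h.card_point, smul_eq_mul, mul_comm, add_comm]

lemma ncard_common_of_collin (h : IsGQ I s t) {p q : P} (hpq : p ≠ q) (hc : Collin I p q) :
    {z | Collin I p z ∧ Collin I z q}.ncard = s + 1 := by
  obtain ⟨l, hp, hq⟩ := hc
  rw [← h.card_line l]
  congr 1
  ext z
  exact ⟨fun hz => h.incident_of_collin hpq hp hq hz.1.symm hz.2,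
    fun hz => ⟨⟨l, hp, hz⟩, ⟨l, hz, hq⟩⟩⟩

/-- Projecting `q` onto the lines through `p` is a bijection from those lines to the common
neighbours. -/
lemma ncard_common_of_not_collin (h : IsGQ I s t) {p q : P} (hc : ¬ Collin I p q) :
    {z | Collin I p z ∧ Collin I z q}.ncard = t + 1 := by
  rw [← h.card_point p]
  have hnot : ∀ l, I p l → ¬ I q l := fun l hp hq => hc ⟨l, hp, hq⟩
  have hex : ∀ l ∈ {l | I p l}, ∃ z, I z l ∧ Collin I q z := fun l hl =>
    (h.proj q l (hnot l hl)).exists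
  choose f hf using hex
  symm
  refine Set.ncard_congr f ?_ ?_ ?_
  · intro l hl
    exact ⟨⟨l, hl, (hf l hl).1⟩, (hf l hl).2.symm⟩
  · intro l m hl hm hlm
    by_contra hne
    have hz := h.eq_of_incident hne (hf l hl).1 hl (hlm ▸ (hf m hm).1) hm
    exact hc (hz ▸ (hf l hl).2.symm)
  · rintro z ⟨⟨l, hp, hz⟩, hzq⟩
    exact ⟨l, hp, (h.proj q l (hnot l hp)).unique (hf l hp) ⟨hz, hzq.symm⟩⟩

/-- The collinearity relation, made reflexive, is strongly regular. -/
lemma collin_mul_self [Fintype P] [DecidableEq P] (h : IsGQ I s t) :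
    relMatrix (Collin I) * relMatrix (Collin I) =
      (t + 1 : ℝ) • (Matrix.of fun _ _ => 1) + (s - t : ℝ) • relMatrix (Collin I)
        + (s * t : ℝ) • 1 := by
  ext x y
  rw [relMatrix_mul_apply]
  simp only [Matrix.add_apply, Matrix.smul_apply, Matrix.of_apply, smul_eq_mul, mul_one]
  by_cases hxy : x = y
  · subst hxy
    have : {z | Collin I x z ∧ Collin I z x} = {z | Collin I x z} := by
      ext z; exact ⟨fun hz => hz.1, fun hz => ⟨hz, Collin.symm hz⟩⟩
    rw [this, h.ncard_collin, relMatrix_of_rel (h.collin_refl x), Matrix.one_apply_eq]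
    push_cast; ring
  · rw [Matrix.one_apply_ne hxy]
    by_cases hc : Collin I x y
    · rw [h.ncard_common_of_collin hxy hc, relMatrix_of_rel hc]
      push_cast; ring
    · rw [h.ncard_common_of_not_collin hc, relMatrix_of_not_rel hc]
      push_cast; ring

/-- Sum one row of the strongly regular identity in two ways and cancel `t + 1`. -/
lemma card_eq [Fintype P] (h : IsGQ I s t) : Fintype.card P = (1 + s) * (1 + s * t) := by
  classical
  obtain ⟨x⟩ := h.nonempty
  have hrow : ∀ x, ∑ y, relMatrix (Collin I) x y = (1 + s * (t + 1) : ℝ) := fun x => by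
    rw [sum_relMatrix, h.ncard_collin]; push_cast; ring
  have h1 : ∑ y, (relMatrix (Collin I) * relMatrix (Collin I)) x y =
      (1 + s * (t + 1) : ℝ) ^ 2 := by
    simp only [Matrix.mul_apply]
    rw [Finset.sum_comm]
    simp only [← Finset.mul_sum, hrow, ← Finset.sum_mul]
    ring
  rw [h.collin_mul_self] at h1
  simp only [Matrix.add_apply, Matrix.smul_apply, Matrix.of_apply, smul_eq_mul, mul_one,
    Finset.sum_add_distrib, ← Finset.mul_sum, hrow, Matrix.one_apply, Finset.sum_ite_eq,
    Finset.mem_univ, if_true, Finset.sum_const, Finset.card_univ, nsmul_eq_mul] at h1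
  have ht : (t + 1 : ℝ) ≠ 0 := by positivity
  have : (Fintype.card P : ℝ) = (1 + s) * (1 + s * t) := by
    apply mul_left_cancel₀ ht
    linear_combination h1
  exact_mod_cast this

/-- Every triad of a generalised quadrangle of order `(s, s ^ 2)` has `s + 1` centres. -/
lemma ncard_centres [Fintype P] (h : IsGQ I s (s ^ 2)) {x y z : P} (hxy : ¬ Collin I x y)
    (hxz : ¬ Collin I x z) (hyz : ¬ Collin I y z) :
    {c | (Collin I x c ∧ Collin I c y) ∧ Collin I c z}.ncard = s + 1 := by
  classical
  set C := relMatrix (Collin I) with hC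
  set O : Set P := {c | Collin I x c ∧ Collin I c y} with hO
  have hOc : O.ncard = s ^ 2 + 1 := h.ncard_common_of_not_collin hxy
  have hCT : Cᵀ = C := by
    ext a b
    simp only [Matrix.transpose_apply, hC, relMatrix, Matrix.of_apply]
    congr 1
    exact propext ⟨Collin.symm, Collin.symm⟩
  set u : P → ℝ := O.indicator 1 with hu
  set e : P → ℝ := Pi.single x 1 + Pi.single y 1 with he
  set j : P → ℝ := 1 with hj
  -- The weight `s` puts `g` in the span of `j` and the `s`-eigenspace of `C`; that this is possible
  -- depends on `t = s ^ 2`.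
  set g : P → ℝ := u + (s : ℝ) • e with hg
  have hne : x ≠ y := fun hh => hxy (hh ▸ h.collin_refl x)
  have hCj : C *ᵥ j = (1 + s * (s ^ 2 + 1) : ℝ) • j := by
    ext a
    simp only [Matrix.mulVec, dotProduct, hj, Pi.one_apply, mul_one, Pi.smul_apply, smul_eq_mul]
    rw [hC, sum_relMatrix, h.ncard_collin]; push_cast; ring
  have hCC : ∀ v : P → ℝ, C *ᵥ (C *ᵥ v) =
      ((s ^ 2 + 1 : ℝ) * (j ⬝ᵥ v)) • j + (s - s ^ 2 : ℝ) • (C *ᵥ v) + (s * s ^ 2 : ℝ) • v := by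
    intro v
    rw [Matrix.mulVec_mulVec, hC, h.collin_mul_self]
    push_cast
    rw [Matrix.add_mulVec, Matrix.add_mulVec, Matrix.smul_mulVec, Matrix.smul_mulVec,
      Matrix.smul_mulVec, Matrix.one_mulVec]
    congr 2
    ext a
    simp [Matrix.mulVec, dotProduct, hj]
  have hju : j ⬝ᵥ u = s ^ 2 + 1 := by
    have : j ⬝ᵥ u = (O.ncard : ℝ) := by
      rw [hj, one_dotProduct, hu, sum_indicator_one]
    rw [this, hOc]; push_cast; ring
  have hu_dot : ∀ (v : P → ℝ) (a : ℝ), (∀ c ∈ O, v c = a) → u ⬝ᵥ v = (s ^ 2 + 1) * a := by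
    intro v a hv
    rw [← hju, dotProduct, dotProduct, Finset.sum_mul]
    refine Finset.sum_congr rfl fun c _ => ?_
    by_cases hcO : c ∈ O
    · simp [hu, hj, hcO, hv c hcO]
    · simp [hu, hcO]
  have he_dot : ∀ v : P → ℝ, e ⬝ᵥ v = v x + v y := fun v => by
    simp [he, add_dotProduct]
  have hCe : ∀ p, (C *ᵥ e) p = C p x + C p y := fun p => by
    simp [he, Matrix.mulVec_add]
  have hxO : x ∉ O := fun hx => hxy hx.2
  have hyO : y ∉ O := fun hy => hxy hy.1
  have huu : u ⬝ᵥ u = s ^ 2 + 1 := by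
    rw [hu_dot u 1 fun c hc => by simp [hu, hj, hc], mul_one]
  -- Two distinct collinear points of `O` would span a line through both `x` and `y`, as there are
  -- no triangles.
  have hOne : ∀ c ∈ O, ∀ d ∈ O, Collin I c d → c = d := by
    rintro c hc d hd ⟨l, hcl, hdl⟩
    by_contra hcd
    exact hxy ⟨l, h.incident_of_collin hcd hcl hdl hc.1 hd.1,
      h.incident_of_collin hcd hcl hdl hc.2.symm hd.2.symm⟩
  have hCu : u ⬝ᵥ (C *ᵥ u) = s ^ 2 + 1 := by
    rw [hu_dot _ 1, mul_one]
    intro c hc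
    rw [Matrix.mulVec, dotProduct, Finset.sum_eq_single c]
    · simp [hC, relMatrix_of_rel (h.collin_refl c), hu, hj, hc]
    · intro d _ hdc
      by_cases hd : d ∈ O
      · rw [hC, relMatrix_of_not_rel fun hcol => hdc (hOne c hc d hd hcol).symm, zero_mul]
      · simp [hu, hd]
    · simp
  have huCe : u ⬝ᵥ (C *ᵥ e) = (s ^ 2 + 1) * 2 := by
    refine hu_dot _ 2 fun c hc => ?_
    rw [hCe, hC, relMatrix_of_rel hc.1.symm, relMatrix_of_rel hc.2]; norm_num
  have heCe : e ⬝ᵥ (C *ᵥ e) = 2 := by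
    rw [he_dot, hCe, hCe, hC, relMatrix_of_rel (h.collin_refl x), relMatrix_of_rel (h.collin_refl y),
      relMatrix_of_not_rel hxy, relMatrix_of_not_rel fun hc => hxy hc.symm]; norm_num
  have hsymm : ∀ v w : P → ℝ, v ⬝ᵥ (C *ᵥ w) = (C *ᵥ v) ⬝ᵥ w := fun v w => by
    rw [Matrix.dotProduct_mulVec, ← Matrix.mulVec_transpose, hCT]
  have heu : e ⬝ᵥ u = 0 := by rw [he_dot]; simp [hu, hxO, hyO]
  have hee : e ⬝ᵥ e = 2 := by
    rw [he_dot]; simp [he, hne, hne.symm]; norm_num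
  have hej : e ⬝ᵥ j = 2 := by
    rw [he_dot]; simp [hj]; norm_num
  have hjj : j ⬝ᵥ j = (1 + s) * (1 + s ^ 3) := by
    have : j ⬝ᵥ j = Fintype.card P := by simp [hj]
    rw [this, h.card_eq]; push_cast; ring
  have hjg : j ⬝ᵥ g = (s + 1) ^ 2 := by
    rw [hg, dotProduct_add, dotProduct_smul, hju, dotProduct_comm, hej, smul_eq_mul]; ring
  have hgg : g ⬝ᵥ g = 3 * s ^ 2 + 1 := by
    simp only [hg, dotProduct_add, add_dotProduct, dotProduct_smul, smul_dotProduct, smul_eq_mul,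
      huu, heu, dotProduct_comm u e, hee]
    ring
  have hgCg : g ⬝ᵥ (C *ᵥ g) = s ^ 2 + 1 + 4 * s * (s ^ 2 + 1) + 2 * s ^ 2 := by
    have heCu : e ⬝ᵥ (C *ᵥ u) = (s ^ 2 + 1) * 2 := by rw [hsymm, dotProduct_comm, huCe]
    simp only [hg, Matrix.mulVec_add, Matrix.mulVec_smul, dotProduct_add, add_dotProduct,
      dotProduct_smul, smul_dotProduct, smul_eq_mul, hCu, huCe, heCe, heCu]
    ring
  have hCgCg : (C *ᵥ g) ⬝ᵥ (C *ᵥ g) = (s ^ 2 + 1) * (s + 1) ^ 4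
      + (s - s ^ 2) * (s ^ 2 + 1 + 4 * s * (s ^ 2 + 1) + 2 * s ^ 2)
      + s ^ 3 * (3 * s ^ 2 + 1) := by
    rw [← hsymm, hCC, dotProduct_add, dotProduct_add, dotProduct_smul, dotProduct_smul,
      dotProduct_smul, hgCg, hgg, dotProduct_comm g j, hjg]
    simp only [smul_eq_mul]; ring
  have hjCg : j ⬝ᵥ (C *ᵥ g) = (1 + s * (s ^ 2 + 1)) * (s + 1) ^ 2 := by
    rw [hsymm, hCj, smul_dotProduct, hjg, smul_eq_mul]
  -- The squared norm of this vector is a polynomial in `s`, assembled from the inner products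
  -- above, and it vanishes identically. The coordinate at `z`, where `g` is zero, then gives the
  -- number of centres.
  have hw : C *ᵥ g - (s : ℝ) • g - (s + 1 : ℝ) • j = 0 := by
    rw [← dotProduct_self_eq_zero]
    simp only [dotProduct_sub, sub_dotProduct, dotProduct_smul, smul_dotProduct, smul_eq_mul,
      hCgCg, hjCg, hgg, hjg, hjj, hgCg, dotProduct_comm (C *ᵥ g) g, dotProduct_comm g j,
      dotProduct_comm (C *ᵥ g) j]
    ring
  have hz := congrFun hw z
  have hzx : z ≠ x := fun hh => hxz (hh ▸ h.collin_refl z)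
  have hzy : z ≠ y := fun hh => hyz (hh ▸ h.collin_refl z)
  have hgz : g z = 0 := by
    have : z ∉ O := fun hzO => hxz hzO.1
    simp [hg, hu, he, this, hzx, hzy]
  have hCuz : (C *ᵥ u) z = ({c | (Collin I x c ∧ Collin I c y) ∧ Collin I c z}.ncard : ℝ) := by
    rw [Set.ncard_eq_toFinset_card', Matrix.mulVec, dotProduct, Finset.card_eq_sum_ones,
      Nat.cast_sum, Set.toFinset_ofPred, Finset.sum_filter]
    refine Finset.sum_congr rfl fun c _ => ?_
    by_cases hcO : c ∈ O
    · by_cases hcz : Collin I c z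
      · rw [if_pos ⟨hcO, hcz⟩, hC, relMatrix_of_rel hcz.symm]; simp [hu, hj, hcO]
      · rw [if_neg fun hh => hcz hh.2, hC, relMatrix_of_not_rel fun hh => hcz hh.symm, zero_mul]
    · rw [if_neg fun hh => hcO hh.1]; simp [hu, hcO]
  have hCgz : (C *ᵥ g) z = (C *ᵥ u) z := by
    rw [hg, Matrix.mulVec_add, Matrix.mulVec_smul, Pi.add_apply, Pi.smul_apply, hCe, hC,
      relMatrix_of_not_rel fun hh => hxz hh.symm, relMatrix_of_not_rel fun hh => hyz hh.symm]
    simp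
  simp only [Pi.sub_apply, Pi.smul_apply, smul_eq_mul, hCgz, hCuz, hgz, hj, Pi.one_apply,
    Pi.zero_apply] at hz
  have : ({c | (Collin I x c ∧ Collin I c y) ∧ Collin I c z}.ncard : ℝ) = ((s + 1 : ℕ) : ℝ) := by
    push_cast; linear_combination hz
  exact_mod_cast this

end IsGQ
end Collinearity

/-! ### Subtended ovoids and their intersections. -/

section Subquadrangle

variable {P L : Type*} {I : P → L → Prop} {P' : Set P} {L' : Set L} {s t : ℕ}

namespace IsSubGQ

/-- Both quadrangles have `s + 1` points per line, so a line of the subquadrangle gains no points in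
the larger one. -/
lemma mem_of_incident (h : IsGQ I s t) {t' : ℕ} (h' : IsSubGQ I P' L' s t') {p : P} {l : L}
    (hl : l ∈ L') (hp : I p l) : p ∈ P' := by
  have hcard := h'.card_line ⟨l, hl⟩
  rw [← Set.ncard_image_of_injective _ Subtype.val_injective] at hcard
  have hsub : Subtype.val '' {q : P' | I q l} ⊆ {p | I p l} := by
    rintro _ ⟨q, hq, rfl⟩
    exact hq
  have heq := Set.eq_of_subset_of_ncard_le hsub (by rw [hcard, h.card_line]) (h.finite_points l)
  have hmem : p ∈ {p | I p l} := hp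
  rw [← heq] at hmem
  obtain ⟨q, -, hq⟩ := hmem
  exact hq ▸ q.2

/-- A line containing two points of the subquadrangle is one of its lines. -/
lemma mem_of_two_points (h : IsGQ I s t) {t' : ℕ} (h' : IsSubGQ I P' L' s t') {p q : P} {l : L}
    (hp : p ∈ P') (hq : q ∈ P') (hpq : p ≠ q) (hpl : I p l) (hql : I q l) : l ∈ L' := by
  obtain ⟨m, hqm⟩ := h'.exists_line ⟨q, hq⟩
  by_cases hpm : I p m
  · exact h.line_unique p q l m hpq hpl hql hpm hqm ▸ m.2
  · obtain ⟨r, ⟨hrm, n, hpn, hrn⟩, -⟩ := h'.proj ⟨p, hp⟩ m hpm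
    -- The projection of `p` onto `m` inside the subquadrangle is also its projection in the whole
    -- quadrangle, namely `q`; the joining line therefore lies in `L'`.
    have hrq : (r : P) = q :=
      (h.proj p m hpm).unique ⟨hrm, n, hpn, hrn⟩ ⟨hqm, l, hpl, hql⟩
    have : l = n := h.line_unique p q l n hpq hpl hql hpn (hrq ▸ hrn)
    exact this ▸ n.2

lemma eq_of_external (h : IsGQ I s t) {t' : ℕ} (h' : IsSubGQ I P' L' s t') {X p q : P} {l : L}
    (hX : X ∉ P') (hXl : I X l) (hp : p ∈ P') (hq : q ∈ P') (hpl : I p l) (hql : I q l) :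
    p = q := by
  by_contra hpq
  exact hX (h'.mem_of_incident h (h'.mem_of_two_points h hp hq hpq hpl hql) hXl)

/-- Every line of a quadrangle of order `(s, s ^ 2)` meets a subquadrangle of order `(s, s)`. -/
lemma exists_mem (h : IsGQ I s (s ^ 2)) [Fintype P] [DecidablePred (· ∈ P')]
    (h' : IsSubGQ I P' L' s s) (l : L) : ∃ p ∈ P', I p l := by
  by_contra! hl
  have hl' : ∀ p, I p l → p ∉ P' := fun p hpl hp => hl p hp hpl
  -- If `l` missed `P'`, each point of `P'` would project to a point of `l`. A point of `l` sees at
  -- most one point of `P'` on each of its `s ^ 2` other lines, which accounts for only `(s + 1) * s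
  -- ^ 2` points, fewer than `(s + 1) * (s ^ 2 + 1)`.
  have hcover : P' ⊆ ⋃ Y ∈ {Y | I Y l}, subtended I P' Y := by
    intro p hp
    obtain ⟨Y, hY, hpY⟩ := (h.proj p l (hl p hp)).exists
    exact Set.mem_biUnion (show Y ∈ {Y | I Y l} from hY) ⟨hp, hpY.symm⟩
  have hsub : ∀ Y, I Y l → (subtended I P' Y).ncard ≤ s ^ 2 := by
    intro Y hY
    have hcard : ({m | I Y m} \ {l}).ncard = s ^ 2 := by
      rw [Set.ncard_sdiff_singleton_of_mem (s := {m | I Y m}) hY, h.card_point]; omega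
    rw [← hcard]
    have : Nonempty L := ⟨l⟩
    choose! f hf using fun p (hp : p ∈ subtended I P' Y) => hp.2
    refine Set.ncard_le_ncard_of_injOn f (fun p hp => ⟨(hf p hp).1, fun hpl => ?_⟩)
      (fun p hp q hq hpq => ?_) ((h.finite_lines Y).subset Set.sdiff_subset)
    · exact hl p hp.1 (hpl ▸ (hf p hp).2)
    · exact h'.eq_of_external h (hl' Y hY) (hf p hp).1 hp.1 hq.1 (hf p hp).2 (hpq ▸ (hf q hq).2)
  have hP' : P'.ncard = (1 + s) * (1 + s * s) := by
    rw [← h'.card_eq, Set.ncard_eq_toFinset_card', Set.toFinset_card]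
  have hfin := h.finite_points l
  have hle : P'.ncard ≤ (s + 1) * s ^ 2 := by
    refine (Set.ncard_le_ncard hcover (Set.toFinite _)).trans
      ((hfin.ncard_biUnion_le _).trans ?_)
    rw [finsum_mem_eq_finite_toFinset_sum _ hfin]
    refine (Finset.sum_le_card_nsmul _ _ (s ^ 2) fun Y hY => hsub Y ?_).trans ?_
    · simpa using hY
    · rw [← Set.ncard_eq_toFinset_card _ hfin, h.card_line, smul_eq_mul]
  rw [hP'] at hle
  nlinarith

/-- Each of the `s ^ 2 + 1` lines through `X` meets `P'` in exactly one point. -/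
lemma ncard_subtended (h : IsGQ I s (s ^ 2)) [Fintype P] [DecidablePred (· ∈ P')]
    (h' : IsSubGQ I P' L' s s) {X : P} (hX : X ∉ P') :
    (subtended I P' X).ncard = s ^ 2 + 1 := by
  rw [← h.card_point X]
  symm
  choose f hf hfl using h'.exists_mem h
  refine Set.ncard_congr (fun l _ => f l) (fun l hl => ⟨hf l, l, hl, hfl l⟩) ?_ ?_
  · intro l m hl hm hlm
    by_contra hne
    exact hX ((h.eq_of_incident hne (hfl l) hl (hlm ▸ hfl m) hm) ▸ hf l)
  · rintro p ⟨hp, l, hXl, hpl⟩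
    exact ⟨l, hXl, h'.eq_of_external h hX hXl (hf l) hp (hfl l) hpl⟩

lemma ncard_inter_of_collin (h : IsGQ I s (s ^ 2)) [Fintype P] [DecidablePred (· ∈ P')]
    (h' : IsSubGQ I P' L' s s) {X Y : P} (hX : X ∉ P') (hne : X ≠ Y)
    (hXY : Collin I X Y) : (subtended I P' X ∩ subtended I P' Y).ncard = 1 := by
  obtain ⟨l, hXl, hYl⟩ := hXY
  obtain ⟨p, hp, hpl⟩ := h'.exists_mem h l
  rw [Set.ncard_eq_one]
  refine ⟨p, Set.eq_singleton_iff_unique_mem.2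
    ⟨⟨⟨hp, l, hXl, hpl⟩, hp, l, hYl, hpl⟩, fun q hq => ?_⟩⟩
  exact h'.eq_of_external h hX hXl hq.1.1 hp
    (h.incident_of_collin hne hXl hYl hq.1.2.symm hq.2.2.symm) hpl

lemma not_collin_of_subtended_eq (h : IsGQ I s (s ^ 2)) [Fintype P] [DecidablePred (· ∈ P')]
    (h' : IsSubGQ I P' L' s s) {X Y : P} (hX : X ∉ P') (hne : X ≠ Y)
    (hXY : subtended I P' X = subtended I P' Y) : ¬ Collin I X Y := by
  intro hc
  have h1 := h'.ncard_inter_of_collin h hX hne hc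
  rw [← hXY, Set.inter_self, h'.ncard_subtended h hX] at h1
  have := h.one_le_t
  omega

/-- One inclusion is immediate, and both sides have `s ^ 2 + 1` points. Consequently all common
neighbours of an antipodal pair lie in `P'`. -/
lemma subtended_eq_common (h : IsGQ I s (s ^ 2)) [Fintype P] [DecidablePred (· ∈ P')]
    (h' : IsSubGQ I P' L' s s) {X Y : P} (hX : X ∉ P') (hne : X ≠ Y)
    (hXY : subtended I P' X = subtended I P' Y) :
    subtended I P' X = {z | Collin I X z ∧ Collin I z Y} := by
  refine Set.eq_of_subset_of_ncard_le (fun z hz => ⟨hz.2, ?_⟩) ?_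
  · rw [hXY] at hz
    exact hz.2.symm
  · rw [h'.ncard_subtended h hX,
      h.ncard_common_of_not_collin (h'.not_collin_of_subtended_eq h hX hne hXY)]

/-- If `X` and `X'` subtend the same ovoid, then a point outside the subquadrangle that is
collinear with neither subtends an ovoid meeting it in `s + 1` points. -/
lemma ncard_inter_of_not_collin (h : IsGQ I s (s ^ 2)) [Fintype P] [DecidablePred (· ∈ P')]
    (h' : IsSubGQ I P' L' s s) {X X' Y : P} (hX : X ∉ P') (hne : X ≠ X')
    (hXX' : subtended I P' X = subtended I P' X') (hXY : ¬ Collin I X Y)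
    (hX'Y : ¬ Collin I X' Y) : (subtended I P' X ∩ subtended I P' Y).ncard = s + 1 := by
  rw [← h.ncard_centres (h'.not_collin_of_subtended_eq h hX hne hXX') hXY hX'Y]
  have hO := h'.subtended_eq_common h hX hne hXX'
  congr 1
  ext z
  constructor
  · rintro ⟨hz, hz'⟩
    rw [hO] at hz
    exact ⟨hz, hz'.2.symm⟩
  · rintro ⟨hz, hz'⟩
    have hz : z ∈ subtended I P' X := hO ▸ hz
    exact ⟨hz, hz.1, hz'.symm⟩

end IsSubGQ
end Subquadrangle

/-! ### Recovering a scheme from its eigenmatrices. -/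

section Scheme

variable {V : Type*} {d : ℕ} {R : Fin (d + 1) → V → V → Prop}
  {P Q : Matrix (Fin (d + 1)) (Fin (d + 1)) ℝ}

lemma sum_smul_relMatrix_apply (hR : ∀ x y, ∃! i, R i x y) (c : Fin (d + 1) → ℝ) {x y : V}
    {r : Fin (d + 1)} (hr : R r x y) : (∑ i, c i • relMatrix (R i)) x y = c r := by
  rw [Matrix.sum_apply, Finset.sum_eq_single r]
  · simp [relMatrix_of_rel hr]
  · intro i _ hir
    simp [relMatrix_of_not_rel fun hi => hir ((hR x y).unique hi hr)]
  · simp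

variable [Fintype V]

/-- The candidates for the minimal idempotents of a scheme with dual eigenmatrix `Q`. -/
noncomputable def idemMatrix (R : Fin (d + 1) → V → V → Prop)
    (Q : Matrix (Fin (d + 1)) (Fin (d + 1)) ℝ) (i : Fin (d + 1)) : Matrix V V ℝ :=
  (Fintype.card V : ℝ)⁻¹ • ∑ r, Q r i • relMatrix (R r)

/-- The Krein parameters of a scheme with eigenmatrices `P` and `Q`. -/
noncomputable def kreinParam (n : ℝ) (P Q : Matrix (Fin (d + 1)) (Fin (d + 1)) ℝ)
    (i j h : Fin (d + 1)) : ℝ :=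
  n⁻¹ * ∑ r, Q r i * Q r j * P h r

/-- The eigenvalue data of the relations of a scheme: `idemMatrix R Q i` is a common eigenvector of
the adjacency matrices, with eigenvalues in row `i` of `P`, and `P`, `Q` are the eigenmatrices. -/
structure HasEigenmatrices (R : Fin (d + 1) → V → V → Prop)
    (P Q : Matrix (Fin (d + 1)) (Fin (d + 1)) ℝ) : Prop where
  card_pos : 0 < Fintype.card V
  diag : ∀ x y, R 0 x y ↔ x = y
  partition : ∀ x y, ∃! i, R i x y
  nonempty : ∀ i, ∃ x y, R i x y
  symm : ∀ i x y, R i x y → R i y x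
  mul_eq : P * Q = (Fintype.card V : ℝ) • 1
  left_col : ∀ i, P i 0 = 1
  right_col : ∀ r, Q r 0 = 1
  rank_ne_zero : ∀ i, Q 0 i ≠ 0
  eigen : ∀ r i, relMatrix (R r) * idemMatrix R Q i = P i r • idemMatrix R Q i

namespace HasEigenmatrices

lemma card_ne_zero (H : HasEigenmatrices R P Q) : (Fintype.card V : ℝ) ≠ 0 :=
  Nat.cast_ne_zero.2 H.card_pos.ne'

lemma mul_eq' (H : HasEigenmatrices R P Q) : Q * P = (Fintype.card V : ℝ) • 1 := by
  have h1 : P * ((Fintype.card V : ℝ)⁻¹ • Q) = 1 := by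
    rw [Matrix.mul_smul, H.mul_eq, smul_smul, inv_mul_cancel₀ H.card_ne_zero, one_smul]
  have h2 := mul_eq_one_comm.1 h1
  rw [Matrix.smul_mul] at h2
  rw [← h2, smul_smul, mul_inv_cancel₀ H.card_ne_zero, one_smul]

lemma relMatrix_zero [DecidableEq V] (H : HasEigenmatrices R P Q) : relMatrix (R 0) = 1 := by
  ext x y
  by_cases h : x = y
  · rw [relMatrix_of_rel ((H.diag x y).2 h), h, Matrix.one_apply_eq]
  · rw [relMatrix_of_not_rel (mt (H.diag x y).1 h), Matrix.one_apply_ne h]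

lemma idemMatrix_apply (H : HasEigenmatrices R P Q) {x y : V} {r : Fin (d + 1)}
    (hr : R r x y) (i : Fin (d + 1)) :
    idemMatrix R Q i x y = (Fintype.card V : ℝ)⁻¹ * Q r i := by
  rw [idemMatrix, Matrix.smul_apply, sum_smul_relMatrix_apply H.partition (fun r => Q r i) hr,
    smul_eq_mul]

/-- Inversion of the definition of `idemMatrix`, by `Q * P = n • 1` read on each relation. -/
lemma relMatrix_eq_sum (H : HasEigenmatrices R P Q) (r : Fin (d + 1)) :
    relMatrix (R r) = ∑ i, P i r • idemMatrix R Q i := by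
  ext x y
  obtain ⟨k, hk, -⟩ := H.partition x y
  have h1 := congrFun (congrFun H.mul_eq' k) r
  rw [Matrix.mul_apply, Matrix.smul_apply, smul_eq_mul] at h1
  simp only [Matrix.sum_apply, Matrix.smul_apply, H.idemMatrix_apply hk, smul_eq_mul]
  have h2 : ∑ i, P i r * ((Fintype.card V : ℝ)⁻¹ * Q k i) =
      (Fintype.card V : ℝ)⁻¹ * ∑ i, Q k i * P i r := by
    rw [Finset.mul_sum]
    exact Finset.sum_congr rfl fun i _ => by ring
  rw [h2, h1, ← mul_assoc, inv_mul_cancel₀ H.card_ne_zero, one_mul, Matrix.one_apply]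
  by_cases hkr : k = r
  · rw [if_pos hkr, relMatrix_of_rel (hkr ▸ hk)]
  · rw [if_neg hkr, relMatrix_of_not_rel fun hr => hkr ((H.partition x y).unique hk hr)]

/-- Expanding the left factor in adjacency matrices, each acting on the right factor by its
eigenvalue, leaves the `(j, i)` entry of `P * Q` as coefficient. -/
lemma idemMatrix_mul (H : HasEigenmatrices R P Q) (i j : Fin (d + 1)) :
    idemMatrix R Q i * idemMatrix R Q j = if i = j then idemMatrix R Q j else 0 := by
  have h1 := congrFun (congrFun H.mul_eq j) i
  rw [Matrix.mul_apply, Matrix.smul_apply, smul_eq_mul, Matrix.one_apply] at h1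
  conv_lhs => rw [idemMatrix]
  rw [Matrix.smul_mul, Finset.sum_mul]
  simp only [Matrix.smul_mul, H.eigen, smul_smul]
  rw [← Finset.sum_smul, smul_smul, Finset.sum_congr rfl fun r _ => mul_comm (Q r i) (P j r), h1]
  by_cases hij : i = j
  · rw [if_pos hij, if_pos hij.symm, mul_one, inv_mul_cancel₀ H.card_ne_zero, one_smul]
  · rw [if_neg hij, if_neg (Ne.symm hij), mul_zero, mul_zero, zero_smul]

lemma isAssociationScheme (H : HasEigenmatrices R P Q) : IsAssociationScheme R where
  diag := H.diag
  partition := H.partition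
  nonempty := H.nonempty
  symm := H.symm
  inter i j h := by
    obtain ⟨x₀, y₀, h₀⟩ := H.nonempty h
    refine ⟨{z | R i x₀ z ∧ R j z y₀}.ncard, fun x y hxy => ?_⟩
    -- The product of two adjacency matrices is a combination of the `idemMatrix R Q k`, whose
    -- entries depend only on the relation containing the pair.
    have key : ∀ x y, R h x y → ({z | R i x z ∧ R j z y}.ncard : ℝ) =
        ∑ k, P k i * P k j * ((Fintype.card V : ℝ)⁻¹ * Q h k) := by
      intro x y hxy
      rw [← relMatrix_mul_apply, H.relMatrix_eq_sum j, Finset.mul_sum, Matrix.sum_apply]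
      refine Finset.sum_congr rfl fun k _ => ?_
      rw [Matrix.mul_smul, H.eigen, smul_smul, Matrix.smul_apply, H.idemMatrix_apply hxy,
        smul_eq_mul]
      ring
    exact_mod_cast (key x y hxy).trans (key x₀ y₀ h₀).symm

lemma isIdempotentOrdering [DecidableEq V] (H : HasEigenmatrices R P Q) :
    IsIdempotentOrdering R (idemMatrix R Q) where
  mem_span i := Submodule.smul_mem _ _ (Submodule.sum_mem _ fun r _ =>
    Submodule.smul_mem _ _ (Submodule.subset_span ⟨r, rfl⟩))
  ne_zero i h := by
    obtain ⟨x⟩ := Fintype.card_pos_iff.1 H.card_pos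
    have h1 := H.idemMatrix_apply ((H.diag x x).2 rfl) i
    rw [h, Matrix.zero_apply] at h1
    exact mul_ne_zero (inv_ne_zero H.card_ne_zero) (H.rank_ne_zero i) h1.symm
  mul_self i := by rw [H.idemMatrix_mul, if_pos rfl]
  mul_of_ne i j hij := by rw [H.idemMatrix_mul, if_neg hij]
  sum_eq := by
    rw [← H.relMatrix_zero, H.relMatrix_eq_sum 0]
    simp [H.left_col]
  zero_eq := by
    ext x y
    obtain ⟨k, hk, -⟩ := H.partition x y
    rw [H.idemMatrix_apply hk, H.right_col, mul_one, Matrix.of_apply]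

lemma isKrein (H : HasEigenmatrices R P Q) :
    IsKrein (idemMatrix R Q) (kreinParam (Fintype.card V) P Q) := by
  intro i j
  ext x y
  obtain ⟨k, hk, -⟩ := H.partition x y
  have h1 : ∀ r, ∑ h, P h r * Q k h = (Fintype.card V : ℝ) * (if k = r then 1 else 0) := by
    intro r
    have := congrFun (congrFun H.mul_eq' k) r
    rw [Matrix.mul_apply, Matrix.smul_apply, smul_eq_mul, Matrix.one_apply] at this
    rw [← this]
    exact Finset.sum_congr rfl fun h _ => mul_comm _ _
  simp only [Matrix.hadamard_apply, Matrix.smul_apply, Matrix.sum_apply,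
    H.idemMatrix_apply hk, smul_eq_mul, kreinParam]
  have hn := H.card_ne_zero
  have h2 : ∑ h, (Fintype.card V : ℝ)⁻¹ * (∑ r, Q r i * Q r j * P h r) *
      ((Fintype.card V : ℝ)⁻¹ * Q k h) = (Fintype.card V : ℝ)⁻¹ * (Q k i * Q k j) := by
    have h3 : ∀ h, (Fintype.card V : ℝ)⁻¹ * (∑ r, Q r i * Q r j * P h r) *
        ((Fintype.card V : ℝ)⁻¹ * Q k h) = ∑ r, (Fintype.card V : ℝ)⁻¹ *
        (Fintype.card V : ℝ)⁻¹ * (Q r i * Q r j) * (P h r * Q k h) := by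
      intro h
      rw [Finset.mul_sum, Finset.sum_mul]
      exact Finset.sum_congr rfl fun r _ => by ring
    rw [Finset.sum_congr rfl fun h _ => h3 h, Finset.sum_comm]
    simp only [← Finset.mul_sum, h1]
    rw [Finset.sum_eq_single k]
    · rw [if_pos rfl]; field_simp
    · intro r _ hrk
      rw [if_neg (Ne.symm hrk)]; ring
    · simp
  rw [h2]
  ring

end HasEigenmatrices

end Scheme

/-! ### Arbitrary orderings of the minimal idempotents. -/

section CometricOrdering

variable {V : Type*} [Fintype V] [DecidableEq V] {d : ℕ} {R : Fin (d + 1) → V → V → Prop}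
  {E : Fin (d + 1) → Matrix V V ℝ}

namespace IsIdempotentOrdering

lemma sum_smul_mul (hE : IsIdempotentOrdering R E) (c : Fin (d + 1) → ℝ) (i : Fin (d + 1)) :
    (∑ j, c j • E j) * E i = c i • E i := by
  rw [Finset.sum_mul, Finset.sum_eq_single i]
  · rw [Matrix.smul_mul, hE.mul_self]
  · intro j _ hji
    rw [Matrix.smul_mul, hE.mul_of_ne j i hji, smul_zero]
  · simp

lemma linearIndependent (hE : IsIdempotentOrdering R E) : LinearIndependent ℝ E := by
  rw [Fintype.linearIndependent_iff]
  intro c hc i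
  have h1 := hE.sum_smul_mul c i
  rw [hc, Matrix.zero_mul] at h1
  exact (smul_eq_zero.1 h1.symm).resolve_right (hE.ne_zero i)

/-- The minimal idempotents span the algebra of the scheme. -/
lemma exists_eq_sum (hE : IsIdempotentOrdering R E) (r : Fin (d + 1)) :
    ∃ c : Fin (d + 1) → ℝ, relMatrix (R r) = ∑ i, c i • E i := by
  have hle : Submodule.span ℝ (Set.range E) ≤
      Submodule.span ℝ (Set.range fun j => relMatrix (R j)) :=
    Submodule.span_le.2 (by rintro _ ⟨i, rfl⟩; exact hE.mem_span i)
  have heq := Submodule.eq_of_le_of_finrank_le hle (by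
    rw [finrank_span_eq_card hE.linearIndependent]
    exact finrank_range_le_card _)
  have hmem : relMatrix (R r) ∈ Submodule.span ℝ (Set.range E) :=
    heq ▸ Submodule.subset_span ⟨r, rfl⟩
  obtain ⟨c, hc⟩ := (Submodule.mem_span_range_iff_exists_fun ℝ).1 hmem
  exact ⟨c, hc.symm⟩

end IsIdempotentOrdering

end CometricOrdering

/-! ### Eigenmatrices and Krein parameters as functions of `s`. -/

section Parameters

/-- The first eigenmatrix of the Penttila–Williford scheme. -/
noncomputable def pwP (s : ℝ) : Matrix (Fin 5) (Fin 5) ℝ :=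
  !![1, (s - 1) * (s ^ 2 + 1), s * (s - 2) * (s ^ 2 + 1), (s - 1) * (s ^ 2 + 1), 1;
     1, s ^ 2 + 1, 0, -(s ^ 2 + 1), -1;
     1, s - 1, -2 * s, s - 1, 1;
     1, -(s - 1), 0, s - 1, -1;
     1, -(s - 1) ^ 2, 2 * s * (s - 2), -(s - 1) ^ 2, 1]

/-- The dual eigenmatrix of the Penttila–Williford scheme. -/
noncomputable def pwQ (s : ℝ) : Matrix (Fin 5) (Fin 5) ℝ :=
  !![1, s * (s - 1) ^ 2 / 2, (s + 1) * (s - 2) * (s ^ 2 + 1) / 2,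
      s * (s - 1) * (s ^ 2 + 1) / 2, s * (s ^ 2 + 1) / 2;
     1, s * (s - 1) / 2, (s + 1) * (s - 2) / 2, -(s * (s - 1) / 2), -(s * (s - 1) / 2);
     1, 0, -(s + 1), 0, s;
     1, -(s * (s - 1) / 2), (s + 1) * (s - 2) / 2, s * (s - 1) / 2, -(s * (s - 1) / 2);
     1, -(s * (s - 1) ^ 2 / 2), (s + 1) * (s - 2) * (s ^ 2 + 1) / 2,
      -(s * (s - 1) * (s ^ 2 + 1) / 2), s * (s ^ 2 + 1) / 2]

lemma pwP_mul_pwQ (s : ℝ) : pwP s * pwQ s = (s ^ 2 * (s ^ 2 - 1)) • 1 := by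
  ext i j
  fin_cases i <;> fin_cases j <;>
    simp [pwP, pwQ, Matrix.mul_apply, Fin.sum_univ_five] <;> ring

lemma kreinParam_comm {d : ℕ} (n : ℝ) (P Q : Matrix (Fin (d + 1)) (Fin (d + 1)) ℝ)
    (i j h : Fin (d + 1)) : kreinParam n P Q i j h = kreinParam n P Q j i h := by
  simp only [kreinParam, mul_comm (Q _ i)]

/-- Each sum in question vanishes identically as a polynomial in `s`; symmetry in `i, j` halves the
cases. -/
lemma kreinParam_pw_eq_zero (n s : ℝ) (i j h : Fin 5)
    (hijh : (i : ℕ) + j < h ∨ (h : ℕ) + j < i ∨ (h : ℕ) + i < j) :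
    kreinParam n (pwP s) (pwQ s) i j h = 0 := by
  wlog hij : i ≤ j generalizing i j
  · rw [kreinParam_comm]
    exact this j i (by omega) (le_of_not_ge hij)
  suffices ∑ r, pwQ s r i * pwQ s r j * pwP s h r = 0 by rw [kreinParam, this, mul_zero]
  fin_cases i <;> fin_cases j <;> fin_cases h <;>
    first
    | (exfalso; revert hijh; decide)
    | (exfalso; revert hij; decide)
    | (simp [pwP, pwQ, Fin.sum_univ_five]; try ring)

lemma kreinParam_pw_ne_zero {n s : ℝ} (hn : n ≠ 0) (hs : 2 < s)
    (hns : n = s ^ 2 * (s ^ 2 - 1)) (i j h : Fin 5)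
    (hijh : (h : ℕ) = i + j) : kreinParam n (pwP s) (pwQ s) i j h ≠ 0 := by
  wlog hij : i ≤ j generalizing i j
  · rw [kreinParam_comm]
    exact this j i (by omega) (le_of_not_ge hij)
  refine mul_ne_zero (inv_ne_zero hn) ?_
  have h0 : s ≠ 0 := by linarith
  have h1 : s - 1 ≠ 0 := by linarith
  have h2 : s - 2 ≠ 0 := by linarith
  have h3 : s + 1 ≠ 0 := by linarith
  have key : ∀ i j h : Fin 5, ∀ a : ℝ, a ≠ 0 →
      ∑ r, pwQ s r i * pwQ s r j * pwP s h r = a →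
      ∑ r, pwQ s r i * pwQ s r j * pwP s h r ≠ 0 := fun i j h a ha hh => hh ▸ ha
  -- Column `0` of `pwQ` is constantly `1`, so this sum is a diagonal entry of `pwP * pwQ`, equal to
  -- `n`.
  have hzero : ∀ j, ∑ r, pwQ s r 0 * pwQ s r j * pwP s j r ≠ 0 := by
    intro j
    have := congrFun (congrFun (pwP_mul_pwQ s) j) j
    rw [Matrix.mul_apply, ← hns, Matrix.smul_apply, Matrix.one_apply_eq, smul_eq_mul,
      mul_one] at this
    refine key _ _ _ n hn ?_
    rw [← this]
    refine Finset.sum_congr rfl fun r _ => ?_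
    have hr : pwQ s r 0 = 1 := by fin_cases r <;> rfl
    rw [hr]; ring
  -- The remaining cases with `0 < i ≤ j` and `i + j ≤ 4`, each with its sum factored; the factor `s
  -- - 2` in two of them is where `s > 2` enters.
  have h112 := key 1 1 2 (s ^ 3 * (s - 1) ^ 3 / 2) (by simp [h0, h1]) (by
    simp [pwP, pwQ, Fin.sum_univ_five]; ring)
  have h123 := key 1 2 3 (s ^ 3 * (s - 1) ^ 2 * (s + 1) * (s - 2) / 2)
    (by simp [h0, h1, h2, h3]) (by simp [pwP, pwQ, Fin.sum_univ_five]; ring)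
  have h134 := key 1 3 4 (s ^ 3 * (s - 1) ^ 3 * (s + 1) / 2)
    (by simp [h0, h1, h3]) (by simp [pwP, pwQ, Fin.sum_univ_five]; ring)
  have h224 := key 2 2 4 (s ^ 3 * (s - 1) ^ 2 * (s + 1) ^ 2 * (s - 2) / 2)
    (by simp [h0, h1, h2, h3]) (by simp [pwP, pwQ, Fin.sum_univ_five]; ring)
  fin_cases i <;> fin_cases j <;> fin_cases h <;>
    first
    | (exfalso; revert hijh; decide)
    | (exfalso; revert hij; decide)
    | exact hzero _
    | assumption

end Parameters

/-! ### The antipodal involution. -/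

section Mate

variable {P L : Type*} {I : P → L → Prop} {P' : Set P} {L' : Set L} {s : ℕ}

namespace IsDoublySubtended

/-- The other external point subtending the same set as `X`. -/
noncomputable def mate (hd : IsDoublySubtended I P') (X : {p : P // p ∉ P'}) :
    {p : P // p ∉ P'} :=
  ⟨(hd X X.2).choose, (hd X X.2).choose_spec.1.1⟩

variable (hd : IsDoublySubtended I P') (X Y : {p : P // p ∉ P'})

lemma mate_ne : hd.mate X ≠ X := fun h =>
  (hd X X.2).choose_spec.1.2.1 (congrArg Subtype.val h)

lemma subtended_mate : subtended I P' (hd.mate X) = subtended I P' X :=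
  (hd X X.2).choose_spec.1.2.2

variable {X Y}

lemma eq_mate (hne : Y ≠ X) (h : subtended I P' Y = subtended I P' X) : Y = hd.mate X :=
  Subtype.ext ((hd X X.2).choose_spec.2 Y ⟨Y.2, fun hh => hne (Subtype.ext hh), h⟩)

variable (X)

lemma mate_mate : hd.mate (hd.mate X) = X :=
  (hd.eq_mate (hd.mate_ne X).symm (hd.subtended_mate X).symm).symm

end IsDoublySubtended

end Mate

/-! ### The relations in terms of collinearity and antipodes. -/

section Relations

variable {P L : Type*} {I : P → L → Prop} {P' : Set P} {L' : Set L} {s : ℕ}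
  {X Y : {p : P // p ∉ P'}}

lemma pwRel_symm (i : Fin 5) (h : pwRel I P' s i X Y) : pwRel I P' s i Y X := by
  fin_cases i
  · exact Eq.symm h
  · exact ⟨fun hc => h.1 hc.symm, by rw [Set.inter_comm]; exact h.2⟩
  · exact ⟨fun hc => h.1 hc.symm, by rw [Set.inter_comm]; exact h.2⟩
  · exact ⟨h.1.symm, h.2.symm⟩
  · exact ⟨h.1.symm, h.2.symm⟩

lemma pwRel_four_iff (hd : IsDoublySubtended I P') :
    pwRel I P' s 4 X Y ↔ Y = hd.mate X :=
  ⟨fun h => hd.eq_mate h.1.symm h.2.symm, fun h => h ▸ ⟨(hd.mate_ne X).symm,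
    (hd.subtended_mate X).symm⟩⟩

variable [Fintype P]

/-- Counting external points by counting in the whole quadrangle. -/
lemma ncard_external_add (p : P → Prop) :
    {z : {p : P // p ∉ P'} | p z}.ncard + {z | z ∈ P' ∧ p z}.ncard = {z | p z}.ncard := by
  rw [← Set.ncard_image_of_injective {z : {p : P // p ∉ P'} | p z} Subtype.val_injective,
    ← Set.ncard_inter_add_ncard_sdiff_eq_ncard {z | p z} P' (Set.toFinite _), add_comm]
  congr 2
  · ext z
    exact and_comm
  · ext z
    constructor
    · rintro ⟨w, hw, rfl⟩
      exact ⟨hw, w.2⟩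
    · rintro ⟨hz, hzP⟩
      exact ⟨⟨z, hzP⟩, hz, rfl⟩

/-- The common neighbours lying in `P'` are exactly the common points of the two ovoids. This turns
ovoid intersections into intersection numbers. -/
lemma ncard_common_external (X Y : {p : P // p ∉ P'}) :
    {z : {p : P // p ∉ P'} | Collin I X.1 z.1 ∧ Collin I z.1 Y.1}.ncard
      + (subtended I P' X ∩ subtended I P' Y).ncard =
      {z | Collin I X.1 z ∧ Collin I z Y.1}.ncard := by
  rw [← ncard_external_add (P' := P') fun z => Collin I X.1 z ∧ Collin I z Y.1]
  congr 2
  ext z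
  exact ⟨fun hz => ⟨hz.1.1, hz.1.2, hz.2.2.symm⟩,
    fun hz => ⟨⟨hz.1, hz.2.1⟩, hz.1, hz.2.2.symm⟩⟩

variable [DecidablePred (· ∈ P')]

/-- A point collinear with both antipodes lies on their ovoid, hence in `P'`. -/
lemma not_collin_of_collin_mate (h : IsGQ I s (s ^ 2)) (h' : IsSubGQ I P' L' s s)
    (hd : IsDoublySubtended I P') (hc : Collin I (hd.mate X).1 Y) : ¬ Collin I X.1 Y := by
  intro hc'
  have hO := h'.subtended_eq_common h X.2 (fun hh => hd.mate_ne X (Subtype.ext hh.symm))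
    (hd.subtended_mate X).symm
  have hY : Y.1 ∈ subtended I P' X := hO ▸ ⟨hc', hc.symm⟩
  exact Y.2 hY.1

/-- A point collinear with neither `X` nor its antipode gives intersection size `s + 1`, not `1`,
while the antipode itself gives `s ^ 2 + 1`. -/
lemma pwRel_one_iff (hs : 1 < s) (h : IsGQ I s (s ^ 2)) (h' : IsSubGQ I P' L' s s)
    (hd : IsDoublySubtended I P') : pwRel I P' s 1 X Y ↔ pwRel I P' s 3 (hd.mate X) Y := by
  constructor
  · rintro ⟨hc, h1⟩
    have hne : hd.mate X ≠ Y := by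
      rintro rfl
      rw [hd.subtended_mate, Set.inter_self, h'.ncard_subtended h X.2] at h1
      nlinarith
    refine ⟨hne, by_contra fun hc' => ?_⟩
    rw [h'.ncard_inter_of_not_collin h X.2 (fun hh => hd.mate_ne X (Subtype.ext hh.symm))
      (hd.subtended_mate X).symm hc hc'] at h1
    omega
  · rintro ⟨hne, hc⟩
    refine ⟨not_collin_of_collin_mate h h' hd hc, ?_⟩
    rw [← hd.subtended_mate X]
    exact h'.ncard_inter_of_collin h (hd.mate X).2 (fun hh => hne (Subtype.ext hh)) hc

lemma pwRel_two_iff (hs : 1 < s) (h : IsGQ I s (s ^ 2)) (h' : IsSubGQ I P' L' s s)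
    (hd : IsDoublySubtended I P') : pwRel I P' s 2 X Y ↔
      Y ≠ hd.mate X ∧ ¬ Collin I X.1 Y.1 ∧ ¬ Collin I (hd.mate X).1 Y.1 := by
  constructor
  · rintro ⟨hc, h1⟩
    have hne : Y ≠ hd.mate X := by
      rintro rfl
      rw [hd.subtended_mate, Set.inter_self, h'.ncard_subtended h X.2] at h1
      nlinarith
    refine ⟨hne, hc, fun hc' => ?_⟩
    rw [← hd.subtended_mate X, h'.ncard_inter_of_collin h (hd.mate X).2
      (fun hh => hne (Subtype.ext hh.symm)) hc'] at h1
    omega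
  · rintro ⟨-, hc, hc'⟩
    exact ⟨hc, h'.ncard_inter_of_not_collin h X.2
      (fun hh => hd.mate_ne X (Subtype.ext hh.symm)) (hd.subtended_mate X).symm hc hc'⟩

lemma pwRel_two_mate_iff (hs : 1 < s) (h : IsGQ I s (s ^ 2)) (h' : IsSubGQ I P' L' s s)
    (hd : IsDoublySubtended I P') : pwRel I P' s 2 (hd.mate X) Y ↔ pwRel I P' s 2 X Y := by
  rw [pwRel_two_iff hs h h' hd, pwRel_two_iff hs h h' hd, hd.mate_mate]
  constructor
  · rintro ⟨-, h2, h3⟩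
    exact ⟨fun hh => h2 (hh ▸ h.collin_refl _), h3, h2⟩
  · rintro ⟨-, h2, h3⟩
    exact ⟨fun hh => h2 (hh ▸ h.collin_refl _), h3, h2⟩

/-- Disjointness comes from collinearity and from the sizes `1`, `s + 1`, `s ^ 2 + 1` being
distinct; exhaustion from asking whether `Y` is equal to, or collinear with, `X` or its antipode. -/
lemma pwRel_partition (hs : 1 < s) (h : IsGQ I s (s ^ 2)) (h' : IsSubGQ I P' L' s s)
    (hd : IsDoublySubtended I P') (X Y : {p : P // p ∉ P'}) :
    ∃! i, pwRel I P' s i X Y := by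
  have h1 := pwRel_one_iff (X := X) (Y := Y) hs h h' hd
  have h2 := pwRel_two_iff (X := X) (Y := Y) hs h h' hd
  have h4 := pwRel_four_iff (X := X) (Y := Y) (s := s) hd
  have c0 : X = Y → Collin I X.1 Y.1 := fun hh => hh ▸ h.collin_refl _
  have c4 : pwRel I P' s 4 X Y → (subtended I P' X ∩ subtended I P' Y).ncard = s ^ 2 + 1 :=
    fun hh => by rw [← hh.2, Set.inter_self, h'.ncard_subtended h X.2]
  have c34 : pwRel I P' s 4 X Y → ¬ Collin I X.1 Y.1 := fun hh =>
    h'.not_collin_of_subtended_eq h X.2 (fun he => hh.1 (Subtype.ext he)) hh.2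
  have hlt : ∀ i j, i < j → pwRel I P' s i X Y → pwRel I P' s j X Y → False := by
    intro i j hij hi hj
    fin_cases i <;> fin_cases j <;> first | exact absurd hij (by decide) | skip
    · exact hj.1 (c0 hi)
    · exact hj.1 (c0 hi)
    · exact hj.1 hi
    · exact hj.1 hi
    · have := hi.2.symm.trans hj.2
      omega
    · exact hi.1 hj.2
    · have := hi.2.symm.trans (c4 hj)
      nlinarith
    · exact hi.1 hj.2
    · have := hi.2.symm.trans (c4 hj)
      nlinarith
    · exact c34 hj hi.2
  have huniq : ∀ i, pwRel I P' s i X Y → ∀ j, pwRel I P' s j X Y → j = i := by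
    intro i hi j hj
    rcases lt_trichotomy i j with hij | hij | hij
    · exact (hlt i j hij hi hj).elim
    · exact hij.symm
    · exact (hlt j i hij hj hi).elim
  have hex : ∃ i, pwRel I P' s i X Y := by
    by_cases hXY : X = Y
    · exact ⟨0, hXY⟩
    · by_cases hc : Collin I X.1 Y.1
      · exact ⟨3, hXY, hc⟩
      · by_cases h4' : Y = hd.mate X
        · exact ⟨4, h4.2 h4'⟩
        · by_cases hc' : Collin I (hd.mate X).1 Y.1
          · exact ⟨1, h1.2 ⟨fun hh => h4' hh.symm, hc'⟩⟩
          · exact ⟨2, h2.2 ⟨h4', hc, hc'⟩⟩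
  obtain ⟨i, hi⟩ := hex
  exact ⟨i, hi, fun j hj => huniq i hi j hj⟩

lemma card_external (h : IsGQ I s (s ^ 2)) (h' : IsSubGQ I P' L' s s) :
    (Fintype.card {p : P // p ∉ P'} : ℝ) = s ^ 2 * (s ^ 2 - 1) := by
  have h1 : Fintype.card {p : P // p ∈ P'} + Fintype.card {p : P // p ∉ P'} = Fintype.card P := by
    rw [Fintype.card_subtype_compl (· ∈ P')]
    exact Nat.add_sub_of_le (Fintype.card_subtype_le _)
  have h2 : Fintype.card {p : P // p ∈ P'} = _ := h'.card_eq
  rw [h2, h.card_eq] at h1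
  have h3 : (((1 + s) * (1 + s * s) + Fintype.card {p : P // p ∉ P'} : ℕ) : ℝ) =
    (((1 + s) * (1 + s * s ^ 2) : ℕ) : ℝ) := by rw [h1]
  push_cast at h3
  linear_combination h3

lemma ncard_collin_external (h : IsGQ I s (s ^ 2)) (h' : IsSubGQ I P' L' s s)
    (X : {p : P // p ∉ P'}) :
    ({z : {p : P // p ∉ P'} | Collin I X.1 z.1}.ncard : ℝ) = s ^ 3 - s ^ 2 + s := by
  have h1 := ncard_external_add (P' := P') (Collin I X.1)
  have h2 : {z | z ∈ P' ∧ Collin I X.1 z}.ncard = s ^ 2 + 1 := h'.ncard_subtended h X.2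
  rw [h2, h.ncard_collin] at h1
  have h3 := congrArg (Nat.cast : ℕ → ℝ) h1
  push_cast at h3
  linear_combination h3

end Relations

/-! ### The algebra generated by the Penttila–Williford relations. -/

section PenttilaWilliford

variable {P L : Type*} {I : P → L → Prop} {P' : Set P} {L' : Set L} {s : ℕ}

lemma relMatrix_pwRel_zero [DecidableEq P] : relMatrix (pwRel I P' s 0) = 1 := by
  ext X Y
  by_cases h : X = Y
  · rw [relMatrix_of_rel (show pwRel I P' s 0 X Y from h), h, Matrix.one_apply_eq]
  · rw [relMatrix_of_not_rel (show ¬ pwRel I P' s 0 X Y from h), Matrix.one_apply_ne h]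

lemma relMatrix_congr {V : Type*} {r r' : V → V → Prop} {x y x' y' : V}
    (h : r x y ↔ r' x' y') : relMatrix r x y = relMatrix r' x' y' := by
  by_cases hr : r x y
  · rw [relMatrix_of_rel hr, relMatrix_of_rel (h.1 hr)]
  · rw [relMatrix_of_not_rel hr, relMatrix_of_not_rel (mt h.2 hr)]

lemma relMatrix_pwRel_transpose (i : Fin 5) :
    (relMatrix (pwRel I P' s i))ᵀ = relMatrix (pwRel I P' s i) := by
  ext X Y
  simp only [Matrix.transpose_apply, relMatrix, Matrix.of_apply]
  congr 1
  exact propext ⟨pwRel_symm i, pwRel_symm i⟩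

lemma relMatrix_collin_external [DecidableEq P] (h : IsGQ I s (s ^ 2)) :
    relMatrix (fun X Y : {p : P // p ∉ P'} => Collin I X.1 Y.1) =
      1 + relMatrix (pwRel I P' s 3) := by
  ext X Y
  by_cases hXY : X = Y
  · subst hXY
    rw [Matrix.add_apply, relMatrix_of_rel (r := fun X Y : {p : P // p ∉ P'} => Collin I X.1 Y.1)
      (h.collin_refl X.1), Matrix.one_apply_eq,
      relMatrix_of_not_rel fun hh => hh.1 rfl, add_zero]
  · rw [Matrix.add_apply, Matrix.one_apply_ne hXY, zero_add]
    exact relMatrix_congr ⟨fun hc => ⟨hXY, hc⟩, fun hc => hc.2⟩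

variable [Fintype P] [DecidablePred (· ∈ P')]

lemma sum_relMatrix_pwRel (hs : 1 < s) (h : IsGQ I s (s ^ 2)) (h' : IsSubGQ I P' L' s s)
    (hd : IsDoublySubtended I P') :
    ∑ i, relMatrix (pwRel I P' s i) = Matrix.of fun _ _ => 1 := by
  ext X Y
  obtain ⟨i, hi, -⟩ := pwRel_partition hs h h' hd X Y
  simpa using sum_smul_relMatrix_apply (pwRel_partition hs h h' hd) (fun _ => 1) hi

lemma relMatrix_pwRel_four_mul_apply (hd : IsDoublySubtended I P')
    (M : Matrix {p : P // p ∉ P'} {p : P // p ∉ P'} ℝ) (X Y : {p : P // p ∉ P'}) :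
    (relMatrix (pwRel I P' s 4) * M) X Y = M (hd.mate X) Y := by
  rw [Matrix.mul_apply, Finset.sum_eq_single (hd.mate X)]
  · rw [relMatrix_of_rel ((pwRel_four_iff hd).2 rfl), one_mul]
  · intro Z _ hZ
    rw [relMatrix_of_not_rel (mt (pwRel_four_iff hd).1 hZ), zero_mul]
  · simp

/-- Multiplication by the antipodal relation permutes the relations. -/
lemma relMatrix_pwRel_four_mul (hs : 1 < s) (h : IsGQ I s (s ^ 2)) (h' : IsSubGQ I P' L' s s)
    (hd : IsDoublySubtended I P') (i : Fin 5) :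
    relMatrix (pwRel I P' s 4) * relMatrix (pwRel I P' s i) =
      relMatrix (pwRel I P' s (![4, 3, 2, 1, 0] i)) := by
  ext X Y
  rw [relMatrix_pwRel_four_mul_apply hd]
  refine relMatrix_congr ?_
  fin_cases i
  · exact eq_comm.trans (pwRel_four_iff hd).symm
  · exact (pwRel_one_iff hs h h' hd).trans (by rw [hd.mate_mate]; rfl)
  · exact pwRel_two_mate_iff hs h h' hd
  · exact (pwRel_one_iff hs h h' hd).symm
  · exact (pwRel_four_iff hd).trans (by rw [hd.mate_mate]; exact eq_comm)

lemma relMatrix_pwRel_mul_four (hs : 1 < s) (h : IsGQ I s (s ^ 2)) (h' : IsSubGQ I P' L' s s)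
    (hd : IsDoublySubtended I P') (i : Fin 5) :
    relMatrix (pwRel I P' s i) * relMatrix (pwRel I P' s 4) =
      relMatrix (pwRel I P' s (![4, 3, 2, 1, 0] i)) := by
  rw [← relMatrix_pwRel_transpose (![4, 3, 2, 1, 0] i), ← relMatrix_pwRel_four_mul hs h h' hd i,
    Matrix.transpose_mul, relMatrix_pwRel_transpose, relMatrix_pwRel_transpose]

lemma sum_relMatrix_pwRel_three (h : IsGQ I s (s ^ 2)) (h' : IsSubGQ I P' L' s s)
    (X : {p : P // p ∉ P'}) :
    ∑ Y, relMatrix (pwRel I P' s 3) X Y = (s - 1) * ((s : ℝ) ^ 2 + 1) := by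
  classical
  have h1 := sum_relMatrix (fun X Y : {p : P // p ∉ P'} => Collin I X.1 Y.1) X
  rw [relMatrix_collin_external h, ncard_collin_external h h'] at h1
  simp only [Matrix.add_apply, Finset.sum_add_distrib, Matrix.one_apply, Finset.sum_ite_eq,
    Finset.mem_univ, if_true] at h1
  linear_combination h1

/-- Each coefficient is a number of common neighbours in the whole quadrangle minus the size of the
ovoid intersection; for antipodes the two agree and leave `0`. -/
lemma relMatrix_collin_external_mul_self (hs : 1 < s) (h : IsGQ I s (s ^ 2))
    (h' : IsSubGQ I P' L' s s) (hd : IsDoublySubtended I P') :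
    relMatrix (fun X Y : {p : P // p ∉ P'} => Collin I X.1 Y.1) *
      relMatrix (fun X Y : {p : P // p ∉ P'} => Collin I X.1 Y.1) =
      ∑ i, (![(s : ℝ) ^ 3 - s ^ 2 + s, s ^ 2, s ^ 2 - s, s, 0] i) •
        relMatrix (pwRel I P' s i) := by
  ext X Y
  obtain ⟨i, hi, -⟩ := pwRel_partition hs h h' hd X Y
  rw [sum_smul_relMatrix_apply (pwRel_partition hs h h' hd) _ hi, relMatrix_mul_apply]
  have hcount := congrArg (Nat.cast : ℕ → ℝ) (ncard_common_external (I := I) X Y)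
  push_cast at hcount
  rw [← eq_sub_iff_add_eq] at hcount
  rw [hcount]
  have hne : ∀ {X Y : {p : P // p ∉ P'}}, X ≠ Y → X.1 ≠ Y.1 := fun hh he => hh (Subtype.ext he)
  fin_cases i
  · obtain rfl : X = Y := hi
    have : {z | Collin I X.1 z ∧ Collin I z X.1} = {z | Collin I X.1 z} := by
      ext z
      exact ⟨fun hz => hz.1, fun hz => ⟨hz, Collin.symm hz⟩⟩
    rw [Set.inter_self, h'.ncard_subtended h X.2, this, h.ncard_collin]
    simp; ring
  · rw [hi.2, h.ncard_common_of_not_collin hi.1]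
    simp
  · rw [hi.2, h.ncard_common_of_not_collin hi.1]
    simp
  · rw [h'.ncard_inter_of_collin h X.2 (hne hi.1) hi.2,
      h.ncard_common_of_collin (hne hi.1) hi.2]
    simp
  · rw [← hi.2, Set.inter_self, h'.ncard_subtended h X.2, h.ncard_common_of_not_collin
      (h'.not_collin_of_subtended_eq h X.2 (hne hi.1) hi.2)]
    simp

lemma relMatrix_pwRel_three_mul_self (hs : 1 < s) (h : IsGQ I s (s ^ 2))
    (h' : IsSubGQ I P' L' s s) (hd : IsDoublySubtended I P') :
    relMatrix (pwRel I P' s 3) * relMatrix (pwRel I P' s 3) =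
      (((s : ℝ) - 1) * (s ^ 2 + 1)) • relMatrix (pwRel I P' s 0)
        + ((s : ℝ) ^ 2) • relMatrix (pwRel I P' s 1)
        + ((s : ℝ) ^ 2 - s) • relMatrix (pwRel I P' s 2)
        + ((s : ℝ) - 2) • relMatrix (pwRel I P' s 3) := by
  classical
  have h1 := relMatrix_collin_external_mul_self hs h h' hd
  rw [relMatrix_collin_external h, Fin.sum_univ_five, relMatrix_pwRel_zero, add_mul, mul_add,
    mul_add, one_mul, one_mul, mul_one] at h1
  simp only [Matrix.cons_val] at h1
  rw [← sub_eq_zero] at h1 ⊢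
  rw [← h1, relMatrix_pwRel_zero]
  module

lemma relMatrix_pwRel_two_eq (hs : 1 < s) (h : IsGQ I s (s ^ 2)) (h' : IsSubGQ I P' L' s s)
    (hd : IsDoublySubtended I P') : relMatrix (pwRel I P' s 2) =
      (Matrix.of fun _ _ => 1) - relMatrix (pwRel I P' s 0) - relMatrix (pwRel I P' s 1)
        - relMatrix (pwRel I P' s 3) - relMatrix (pwRel I P' s 4) := by
  rw [← sum_relMatrix_pwRel hs h h' hd, Fin.sum_univ_five]
  abel

/-- These are the valencies: `R_3` by counting, `R_1` through `A_1 = A_3 A_4`, and `R_2` as the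
complement. -/
lemma ones_mul_relMatrix_pwRel (hs : 1 < s) (h : IsGQ I s (s ^ 2)) (h' : IsSubGQ I P' L' s s)
    (hd : IsDoublySubtended I P') (i : Fin 5) :
    (Matrix.of fun _ _ => 1) * relMatrix (pwRel I P' s i) =
      pwP s 0 i • (Matrix.of fun _ _ => 1) := by
  classical
  set J : Matrix {p : P // p ∉ P'} {p : P // p ∉ P'} ℝ := Matrix.of fun _ _ => 1 with hJ
  have h0 : J * relMatrix (pwRel I P' s 0) = J := by rw [relMatrix_pwRel_zero, mul_one]
  have h3 : J * relMatrix (pwRel I P' s 3) = (((s : ℝ) - 1) * (s ^ 2 + 1)) • J := by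
    ext X Y
    rw [← relMatrix_pwRel_transpose, Matrix.mul_apply, Matrix.smul_apply]
    simp only [hJ, Matrix.of_apply, one_mul, Matrix.transpose_apply, smul_eq_mul, mul_one]
    exact sum_relMatrix_pwRel_three h h' Y
  have h4 : J * relMatrix (pwRel I P' s 4) = J := by
    ext X Y
    rw [← Matrix.transpose_apply (J * _), Matrix.transpose_mul, relMatrix_pwRel_transpose,
      relMatrix_pwRel_four_mul_apply hd]
    rfl
  have h1 : J * relMatrix (pwRel I P' s 1) = (((s : ℝ) - 1) * (s ^ 2 + 1)) • J := by
    have : relMatrix (pwRel I P' s 1) = relMatrix (pwRel I P' s 3) * relMatrix (pwRel I P' s 4) :=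
      (relMatrix_pwRel_mul_four hs h h' hd 3).symm
    rw [this, ← mul_assoc, h3, Matrix.smul_mul, h4]
  have hJJ : J * J = ((s : ℝ) ^ 2 * (s ^ 2 - 1)) • J := by
    ext X Y
    simp [Matrix.mul_apply, hJ, ← card_external h h']
  fin_cases i
  · simpa [pwP] using h0
  · simpa [pwP] using h1
  · rw [show ((⟨2, by omega⟩ : Fin 5)) = 2 from rfl, relMatrix_pwRel_two_eq hs h h' hd]
    simp only [mul_sub, ← hJ, h0, h1, h3, h4, hJJ]
    simp only [pwP, Matrix.of_apply, Matrix.cons_val]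
    module
  · simpa [pwP] using h3
  · simpa [pwP] using h4

lemma relMatrix_mul_idemMatrix {V : Type*} [Fintype V] {d : ℕ} (R : Fin (d + 1) → V → V → Prop)
    (Q : Matrix (Fin (d + 1)) (Fin (d + 1)) ℝ) (M : Matrix V V ℝ) (i : Fin (d + 1)) :
    M * idemMatrix R Q i =
      (Fintype.card V : ℝ)⁻¹ • ∑ r, Q r i • (M * relMatrix (R r)) := by
  rw [idemMatrix, Matrix.mul_smul, Finset.mul_sum]
  simp only [Matrix.mul_smul]

lemma idemMatrix_five {V : Type*} [Fintype V] (R : Fin 5 → V → V → Prop)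
    (Q : Matrix (Fin 5) (Fin 5) ℝ) (i : Fin 5) :
    idemMatrix (d := 4) R Q i = (Fintype.card V : ℝ)⁻¹ • (Q 0 i • relMatrix (R 0)
      + Q 1 i • relMatrix (R 1) + Q 2 i • relMatrix (R 2) + Q 3 i • relMatrix (R 3)
      + Q 4 i • relMatrix (R 4)) :=
  congrArg _ (Fin.sum_univ_five _)

lemma relMatrix_mul_idemMatrix_five {V : Type*} [Fintype V] (R : Fin 5 → V → V → Prop)
    (Q : Matrix (Fin 5) (Fin 5) ℝ) (M : Matrix V V ℝ) (i : Fin 5) :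
    M * idemMatrix (d := 4) R Q i = (Fintype.card V : ℝ)⁻¹ • (Q 0 i • (M * relMatrix (R 0))
      + Q 1 i • (M * relMatrix (R 1)) + Q 2 i • (M * relMatrix (R 2))
      + Q 3 i • (M * relMatrix (R 3)) + Q 4 i • (M * relMatrix (R 4))) := by
  rw [idemMatrix_five, Matrix.mul_smul]
  simp only [mul_add, Matrix.mul_smul]

lemma ones_mul_idemMatrix (hs : 1 < s) (h : IsGQ I s (s ^ 2))
    (h' : IsSubGQ I P' L' s s) (hd : IsDoublySubtended I P') (i : Fin 5) :
    (Matrix.of fun _ _ => 1) * idemMatrix (pwRel I P' s) (pwQ s) i =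
      (if i = 0 then (s : ℝ) ^ 2 * (s ^ 2 - 1) else 0) •
        idemMatrix (pwRel I P' s) (pwQ s) i := by
  have hs1 : (1 : ℝ) < s := by exact_mod_cast hs
  have hn : (s : ℝ) ^ 2 * (s ^ 2 - 1) ≠ 0 := by
    refine mul_ne_zero (by positivity) ?_
    nlinarith
  have h1 := congrFun (congrFun (pwP_mul_pwQ (s : ℝ)) 0) i
  rw [Matrix.mul_apply, Matrix.smul_apply, Matrix.one_apply, smul_eq_mul] at h1
  rw [relMatrix_mul_idemMatrix]
  simp only [ones_mul_relMatrix_pwRel hs h h' hd, smul_smul]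
  rw [← Finset.sum_smul, Finset.sum_congr rfl fun r _ => mul_comm (pwQ (s : ℝ) r i) _, h1,
    card_external h h', smul_smul]
  by_cases hi : i = 0
  · subst hi
    have hq : ∀ r, pwQ (s : ℝ) r 0 = 1 := by intro r; fin_cases r <;> rfl
    simp only [if_true, mul_one, inv_mul_cancel₀ hn, idemMatrix, card_external h h', smul_smul,
      mul_inv_cancel₀ hn, hq, one_smul, sum_relMatrix_pwRel hs h h' hd]
  · rw [if_neg hi, if_neg (Ne.symm hi), mul_zero, mul_zero, zero_smul, zero_smul]

/-- Left multiplication reverses the order of the relations, and each column of `pwQ` is symmetric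
or antisymmetric under that reversal. -/
lemma four_mul_idemMatrix (hs : 1 < s) (h : IsGQ I s (s ^ 2))
    (h' : IsSubGQ I P' L' s s) (hd : IsDoublySubtended I P') (i : Fin 5) :
    relMatrix (pwRel I P' s 4) * idemMatrix (pwRel I P' s) (pwQ s) i =
      pwP s i 4 • idemMatrix (pwRel I P' s) (pwQ s) i := by
  rw [relMatrix_mul_idemMatrix_five, idemMatrix_five, smul_comm]
  congr 1
  simp only [relMatrix_pwRel_four_mul hs h h' hd, Matrix.cons_val]
  fin_cases i <;> simp only [pwP, pwQ, Matrix.of_apply, Matrix.cons_val, Fin.reduceFinMk,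
    Fin.zero_eta, Fin.mk_one] <;> module

/-- All products `A_3 A_r` follow from `A_3 ^ 2`: the case `r = 1` by a further factor `A_4`, the
case `r = 2` by complement. What remains is a comparison of coefficients. -/
lemma three_mul_idemMatrix (hs : 1 < s) (h : IsGQ I s (s ^ 2))
    (h' : IsSubGQ I P' L' s s) (hd : IsDoublySubtended I P') (i : Fin 5) :
    relMatrix (pwRel I P' s 3) * idemMatrix (pwRel I P' s) (pwQ s) i =
      pwP s i 3 • idemMatrix (pwRel I P' s) (pwQ s) i := by
  classical
  have h33 := relMatrix_pwRel_three_mul_self hs h h' hd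
  have h30 : relMatrix (pwRel I P' s 3) * relMatrix (pwRel I P' s 0) =
      relMatrix (pwRel I P' s 3) := by rw [relMatrix_pwRel_zero, mul_one]
  have h04 : relMatrix (pwRel I P' s 0) * relMatrix (pwRel I P' s 4) =
      relMatrix (pwRel I P' s 4) := relMatrix_pwRel_mul_four hs h h' hd 0
  have h14 : relMatrix (pwRel I P' s 1) * relMatrix (pwRel I P' s 4) =
      relMatrix (pwRel I P' s 3) := relMatrix_pwRel_mul_four hs h h' hd 1
  have h24 : relMatrix (pwRel I P' s 2) * relMatrix (pwRel I P' s 4) =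
      relMatrix (pwRel I P' s 2) := relMatrix_pwRel_mul_four hs h h' hd 2
  have h34 : relMatrix (pwRel I P' s 3) * relMatrix (pwRel I P' s 4) =
      relMatrix (pwRel I P' s 1) := relMatrix_pwRel_mul_four hs h h' hd 3
  have h31 : relMatrix (pwRel I P' s 3) * relMatrix (pwRel I P' s 1) =
      (((s : ℝ) - 1) * (s ^ 2 + 1)) • relMatrix (pwRel I P' s 4)
        + ((s : ℝ) ^ 2) • relMatrix (pwRel I P' s 3)
        + ((s : ℝ) ^ 2 - s) • relMatrix (pwRel I P' s 2)
        + ((s : ℝ) - 2) • relMatrix (pwRel I P' s 1) := by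
    rw [← h34, ← mul_assoc, h33]
    simp only [add_mul, Matrix.smul_mul, h04, h14, h24, h34]
  have h3J : relMatrix (pwRel I P' s 3) * (Matrix.of fun _ _ => 1) =
      (((s : ℝ) - 1) * (s ^ 2 + 1)) • ∑ i, relMatrix (pwRel I P' s i) := by
    ext X Y
    rw [sum_relMatrix_pwRel hs h h' hd, Matrix.mul_apply, Matrix.smul_apply]
    simp only [Matrix.of_apply, mul_one, smul_eq_mul]
    exact sum_relMatrix_pwRel_three h h' X
  have h32 : relMatrix (pwRel I P' s 3) * relMatrix (pwRel I P' s 2) =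
      (((s : ℝ) - 1) * (s ^ 2 + 1)) • ∑ i, relMatrix (pwRel I P' s i)
        - relMatrix (pwRel I P' s 3)
        - ((((s : ℝ) - 1) * (s ^ 2 + 1)) • relMatrix (pwRel I P' s 4)
        + ((s : ℝ) ^ 2) • relMatrix (pwRel I P' s 3)
        + ((s : ℝ) ^ 2 - s) • relMatrix (pwRel I P' s 2)
        + ((s : ℝ) - 2) • relMatrix (pwRel I P' s 1))
        - ((((s : ℝ) - 1) * (s ^ 2 + 1)) • relMatrix (pwRel I P' s 0)
        + ((s : ℝ) ^ 2) • relMatrix (pwRel I P' s 1)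
        + ((s : ℝ) ^ 2 - s) • relMatrix (pwRel I P' s 2)
        + ((s : ℝ) - 2) • relMatrix (pwRel I P' s 3))
        - relMatrix (pwRel I P' s 1) := by
    conv_lhs => rw [relMatrix_pwRel_two_eq hs h h' hd]
    simp only [mul_sub, h3J, h30, h31, h33, h34]
  rw [relMatrix_mul_idemMatrix_five, idemMatrix_five, smul_comm]
  congr 1
  simp only [h30, h31, h32, h33, h34, Fin.sum_univ_five]
  fin_cases i <;> simp only [pwP, pwQ, Matrix.of_apply, Matrix.cons_val, Fin.reduceFinMk,
    Fin.zero_eta, Fin.mk_one] <;> module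

lemma relMatrix_pwRel_mul_idemMatrix (hs : 1 < s) (h : IsGQ I s (s ^ 2))
    (h' : IsSubGQ I P' L' s s) (hd : IsDoublySubtended I P') (r i : Fin 5) :
    relMatrix (pwRel I P' s r) * idemMatrix (pwRel I P' s) (pwQ s) i =
      pwP s i r • idemMatrix (pwRel I P' s) (pwQ s) i := by
  classical
  have h0 : relMatrix (pwRel I P' s 0) * idemMatrix (pwRel I P' s) (pwQ s) i =
      idemMatrix (pwRel I P' s) (pwQ s) i := by rw [relMatrix_pwRel_zero, one_mul]
  have h3 := three_mul_idemMatrix hs h h' hd i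
  have h4 := four_mul_idemMatrix hs h h' hd i
  have h1 : relMatrix (pwRel I P' s 1) * idemMatrix (pwRel I P' s) (pwQ s) i =
      (pwP s i 4 * pwP s i 3) • idemMatrix (pwRel I P' s) (pwQ s) i := by
    have : relMatrix (pwRel I P' s 1) = relMatrix (pwRel I P' s 3) * relMatrix (pwRel I P' s 4) :=
      (relMatrix_pwRel_mul_four hs h h' hd 3).symm
    rw [this, mul_assoc, h4, Matrix.mul_smul, h3, smul_smul]
  have h2 : relMatrix (pwRel I P' s 2) * idemMatrix (pwRel I P' s) (pwQ s) i =
      ((if i = 0 then (s : ℝ) ^ 2 * (s ^ 2 - 1) else 0) - 1 - pwP s i 4 * pwP s i 3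
        - pwP s i 3 - pwP s i 4) • idemMatrix (pwRel I P' s) (pwQ s) i := by
    rw [relMatrix_pwRel_two_eq hs h h' hd]
    simp only [sub_mul, ones_mul_idemMatrix hs h h' hd, h0, h1, h3, h4]
    module
  fin_cases r
  · refine h0.trans ?_
    rw [show pwP (s : ℝ) i ⟨0, by omega⟩ = 1 by fin_cases i <;> rfl, one_smul]
  · refine h1.trans ?_
    congr 1
    fin_cases i <;> simp [pwP]
  · refine h2.trans ?_
    congr 1
    fin_cases i <;> simp [pwP] <;> ring
  · exact h3
  · exact h4

end PenttilaWilliford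

/-! ### Antipodal signs and sets of half size. -/

section Antipodal

variable {V : Type*} [Fintype V] {τ : V → V}

lemma ncard_eq_half (hτ : Function.Involutive τ) {θ : Set V} (hne : θ ≠ ∅)
    (hnu : θ ≠ Set.univ) {κ : ℝ} (h : ∀ x, charVec θ x + charVec θ (τ x) = κ) :
    (θ.ncard : ℝ) = 1 / 2 * Fintype.card V := by
  have hval : ∀ x, charVec θ x = 0 ∨ charVec θ x = 1 := fun x => by
    by_cases hx : x ∈ θ <;> simp [charVec, hx]
  -- A point in `θ` forces `κ ∈ {1, 2}`, and a point outside forces `κ ∈ {0, 1}`.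
  have hκ : κ = 1 := by
    obtain ⟨x, hx⟩ := Set.nonempty_iff_ne_empty.2 hne
    obtain ⟨y, hy⟩ := (Set.ne_univ_iff_exists_notMem θ).1 hnu
    have h1 := h x
    have h2 := h y
    have h3 : charVec θ x = 1 := by simp [charVec, hx]
    have h4 : charVec θ y = 0 := by simp [charVec, hy]
    rcases hval (τ x) with h5 | h5 <;> rcases hval (τ y) with h6 | h6 <;>
      rw [h3, h5] at h1 <;> rw [h4, h6] at h2 <;> linarith
  have hsum : ∑ x, charVec θ x = θ.ncard := sum_indicator_one θ
  have hsum' : ∑ x, charVec θ (τ x) = θ.ncard := by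
    rw [← hsum]
    exact Equiv.sum_comp hτ.toPerm (charVec θ)
  have := Finset.sum_congr (rfl : (Finset.univ : Finset V) = Finset.univ) fun x _ => h x
  rw [Finset.sum_add_distrib, hsum, hsum', Finset.sum_const, Finset.card_univ, hκ,
    nsmul_eq_mul] at this
  linarith

variable {r : V → V → Prop}

lemma relMatrix_mulVec_of_graph (hr : ∀ x y, r x y ↔ y = τ x) (v : V → ℝ) (x : V) :
    (relMatrix r *ᵥ v) x = v (τ x) := by
  rw [Matrix.mulVec, dotProduct, Finset.sum_eq_single (τ x)]
  · rw [relMatrix_of_rel ((hr _ _).2 rfl), one_mul]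
  · intro y _ hy
    rw [relMatrix_of_not_rel (mt (hr _ _).1 hy), zero_mul]
  · simp

lemma relMatrix_mul_of_graph (hr : ∀ x y, r x y ↔ y = τ x) (M : Matrix V V ℝ) (x y : V) :
    (relMatrix r * M) x y = M (τ x) y :=
  relMatrix_mulVec_of_graph hr (fun z => M z y) x

lemma vecMul_relMatrix_of_graph (hτ : Function.Involutive τ) (hr : ∀ x y, r x y ↔ y = τ x)
    (v : V → ℝ) (y : V) : (v ᵥ* relMatrix r) y = v (τ y) := by
  rw [Matrix.vecMul, dotProduct, Finset.sum_eq_single (τ y)]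
  · rw [relMatrix_of_rel ((hr _ _).2 (hτ y).symm), mul_one]
  · intro x _ hx
    rw [relMatrix_of_not_rel fun h => hx (by rw [(hr _ _).1 h, hτ]), mul_zero]
  · simp

variable [DecidableEq V] {R : Fin 5 → V → V → Prop} {E : Fin 5 → Matrix V V ℝ}

/-- In a cometric scheme with a fixed-point-free involution among its relations, the odd
idempotents are those on which the involution acts as `-1`. -/
lemma IsCometricOrdering.exists_signs (hE : IsCometricOrdering (d := 4) R E)
    (hτ : Function.Involutive τ) {k : Fin 5} (hr : ∀ x y, R k x y ↔ y = τ x) (x₀ : V)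
    (hx₀ : τ x₀ ≠ x₀) :
    ∃ c : Fin 5 → ℝ, relMatrix (R k) = ∑ i, c i • E i ∧
      c 0 = 1 ∧ c 1 = -1 ∧ c 2 = 1 ∧ c 3 = -1 ∧ c 4 = 1 := by
  obtain ⟨hid, q, hq, -, hq'⟩ := hE
  obtain ⟨c, hc⟩ := hid.exists_eq_sum k
  have hT : ∀ i, relMatrix (R k) * E i = c i • E i := fun i => hc ▸ hid.sum_smul_mul c i
  have hentry : ∀ i x y, E i (τ x) y = c i * E i x y := fun i x y => by
    rw [← relMatrix_mul_of_graph hr (E i) x y, hT, Matrix.smul_apply, smul_eq_mul]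
  have hsq : ∀ i, c i * c i = 1 := fun i => by
    have h1 : (c i * c i) • E i = (1 : ℝ) • E i := by
      ext x y
      rw [Matrix.smul_apply, one_smul, smul_eq_mul, mul_assoc, ← hentry, ← hentry, hτ]
    exact smul_left_injective ℝ (hid.ne_zero i) h1
  have h0 : c 0 = 1 := by
    refine smul_left_injective ℝ (hid.ne_zero 0) (?_ : c 0 • E 0 = (1 : ℝ) • E 0)
    ext x y
    rw [Matrix.smul_apply, one_smul, smul_eq_mul, ← hentry, hid.zero_eq]
    rfl
  have hn : (Fintype.card V : ℝ) ≠ 0 :=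
    Nat.cast_ne_zero.2 (Fintype.card_pos_iff.2 ⟨x₀⟩).ne'
  have hmul : ∀ i j h : Fin 5, (h : ℕ) = i + j → c h = c i * c j := by
    intro i j h hijh
    -- The rows of `E i ⊙ E j` transform under `τ` by `c i * c j`, so idempotents with any other
    -- sign cannot occur in it.
    have hlin : ∑ l, (q i j l * (c i * c j - c l)) • E l = 0 := by
      have h1 : ∑ l, q i j l • E l = (Fintype.card V : ℝ) • (E i ⊙ E j) := by
        rw [hq i j, smul_smul, mul_inv_cancel₀ hn, one_smul]
      have h2 : relMatrix (R k) * ∑ l, q i j l • E l = (c i * c j) • ∑ l, q i j l • E l := by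
        rw [h1]
        ext x y
        rw [relMatrix_mul_of_graph hr]
        simp only [Matrix.smul_apply, Matrix.hadamard_apply, hentry, smul_eq_mul]
        ring
      rw [Finset.mul_sum, Finset.smul_sum, ← sub_eq_zero, ← Finset.sum_sub_distrib] at h2
      rw [← neg_eq_zero, ← h2, ← Finset.sum_neg_distrib]
      refine Finset.sum_congr rfl fun l _ => ?_
      rw [Matrix.mul_smul, hT]
      module
    have h3 := Fintype.linearIndependent_iff.1 hid.linearIndependent _ hlin h
    linarith [(mul_eq_zero.1 h3).resolve_left (hq' i j h hijh)]
  have h2 : c 2 = 1 := (hmul 1 1 2 rfl).trans (hsq 1)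
  have h3 : c 3 = c 1 := by rw [hmul 1 2 3 rfl, h2, mul_one]
  have h4 : c 4 = 1 := by rw [hmul 1 3 4 rfl, h3, hsq]
  -- If `c 1 = 1`, all signs are `1` and the permutation matrix of `τ` is the identity, although `τ`
  -- moves `x₀`.
  have h1 : c 1 = -1 := by
    refine (mul_self_eq_one_iff.1 (hsq 1)).resolve_left fun h1 => hx₀ ?_
    have hall : ∀ i, c i = 1 := by
      intro i
      fin_cases i
      exacts [h0, h1, h2, h3.trans h1, h4]
    have hone : relMatrix (R k) = 1 := by
      rw [hc, ← hid.sum_eq]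
      exact Finset.sum_congr rfl fun i _ => by rw [hall, one_smul]
    by_contra hne
    have := relMatrix_of_rel ((hr x₀ (τ x₀)).2 rfl)
    rw [hone, Matrix.one_apply_ne (Ne.symm hne)] at this
    exact zero_ne_one this
  exact ⟨c, hc, h0, h1, h2, h3.trans h1, h4⟩

lemma IsIdempotentOrdering.mulVec_zero_apply (hid : IsIdempotentOrdering (d := 4) R E)
    (w : V → ℝ) (x y : V) : (E 0 *ᵥ w) x = (E 0 *ᵥ w) y := by
  rw [hid.zero_eq]
  rfl

lemma IsIdempotentOrdering.vecMul_zero_apply (hid : IsIdempotentOrdering (d := 4) R E)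
    (w : V → ℝ) (x y : V) : (w ᵥ* E 0) x = (w ᵥ* E 0) y := by
  rw [hid.zero_eq]
  rfl

lemma IsCometricOrdering.ncard_eq_half (hE : IsCometricOrdering (d := 4) R E)
    (hτ : Function.Involutive τ) {k : Fin 5} (hr : ∀ x y, R k x y ↔ y = τ x) (x₀ : V)
    (hx₀ : τ x₀ ≠ x₀) {θ : Set V} (hne : θ ≠ ∅) (hnu : θ ≠ Set.univ)
    (hθ : IsIntriguing (d := 4) E 1 θ ∨ IsIntriguing (d := 4) E 3 θ ∨
      IsTDesign (d := 4) E {2, 4} θ) :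
    (θ.ncard : ℝ) = 1 / 2 * Fintype.card V := by
  obtain ⟨c, hc, h0, h1, h2, h3, h4⟩ := hE.exists_signs hτ hr x₀ hx₀
  have hid := hE.1
  have hT : ∀ i, relMatrix (R k) * E i = c i • E i := fun i => hc ▸ hid.sum_smul_mul c i
  have hintr : ∀ i, c i = -1 → IsIntriguing (d := 4) E i θ →
      (θ.ncard : ℝ) = 1 / 2 * Fintype.card V := by
    intro i hi hθ
    obtain ⟨u, ⟨w, rfl⟩, v, ⟨w', rfl⟩, hχ⟩ := Submodule.mem_sup.1 hθ
    simp only [Matrix.mulVecLin_apply] at hχ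
    -- The component in `eigSpace E i` changes sign under `τ` and cancels; the constant component in
    -- `eigSpace E 0` doubles.
    refine _root_.ncard_eq_half hτ hne hnu (κ := 2 * (E 0 *ᵥ w) x₀) fun x => ?_
    rw [← relMatrix_mulVec_of_graph hr (charVec θ) x, ← hχ, Matrix.mulVec_add,
      Matrix.mulVec_mulVec, Matrix.mulVec_mulVec, hT, hT, h0, hi, Matrix.smul_mulVec,
      Matrix.smul_mulVec, hid.mulVec_zero_apply w x₀ x]
    simp only [Pi.add_apply, Pi.smul_apply, smul_eq_mul]
    ring
  rcases hθ with hθ | hθ | hθ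
  · exact hintr 1 h1 hθ
  · exact hintr 3 h3 hθ
  · have hd2 : charVec θ ᵥ* E 2 = 0 := hθ 2 (by simp)
    have hd4 : charVec θ ᵥ* E 4 = 0 := hθ 4 (by simp)
    have hsum : charVec θ = ∑ i, charVec θ ᵥ* E i := by
      rw [← Matrix.vecMul_sum, hid.sum_eq, Matrix.vecMul_one]
    have hTsum : charVec θ ᵥ* relMatrix (R k) = ∑ i, c i • (charVec θ ᵥ* E i) := by
      rw [hc, Matrix.vecMul_sum]
      simp only [Matrix.vecMul_smul]
    rw [Fin.sum_univ_five] at hsum hTsum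
    refine _root_.ncard_eq_half hτ hne hnu (κ := 2 * (charVec θ ᵥ* E 0) x₀) fun x => ?_
    rw [← vecMul_relMatrix_of_graph hτ hr (charVec θ) x, hTsum, h0, h1, h2, h3, h4, hd2, hd4,
      hid.vecMul_zero_apply _ x₀ x]
    have hx := congrFun hsum x
    rw [hd2, hd4] at hx
    simp only [Pi.add_apply, Pi.smul_apply, smul_eq_mul, Pi.zero_apply] at hx ⊢
    linear_combination hx

end Antipodal

/-! ### Verification of the eigenmatrices and the final assembly. -/

section PenttilaWilliford

variable {P L : Type*} {I : P → L → Prop} {P' : Set P} {L' : Set L} {s : ℕ} [Fintype P]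
  [DecidablePred (· ∈ P')]

lemma hasEigenmatrices_pwRel (hs : 2 < s) (h : IsGQ I s (s ^ 2)) (h' : IsSubGQ I P' L' s s)
    (hd : IsDoublySubtended I P') :
    HasEigenmatrices (d := 4) (pwRel I P' s) (pwP s) (pwQ s) := by
  have hs1 : 1 < s := by omega
  have hs' : (2 : ℝ) < s := by exact_mod_cast hs
  have hcard := card_external h h'
  have hpos : 0 < Fintype.card {p : P // p ∉ P'} := by
    have : (0 : ℝ) < Fintype.card {p : P // p ∉ P'} := by
      rw [hcard]
      exact mul_pos (by positivity) (by nlinarith)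
    exact_mod_cast this
  have e0 : (s : ℝ) ≠ 0 := by linarith
  have e1 : (s : ℝ) - 1 ≠ 0 := by linarith
  have e2 : (s : ℝ) - 2 ≠ 0 := by linarith
  have e3 : (s : ℝ) + 1 ≠ 0 := by linarith
  have e4 : (s : ℝ) ^ 2 + 1 ≠ 0 := by positivity
  refine ⟨hpos, fun x y => Iff.rfl, pwRel_partition hs1 h h' hd, fun i => ?_,
    fun i x y => pwRel_symm i, ?_, ?_, ?_, ?_, relMatrix_pwRel_mul_idemMatrix hs1 h h' hd⟩
  -- An empty relation would have valency zero; for `R_2` the valency contains the factor `s - 2`.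
  · by_contra! hempty
    obtain ⟨x⟩ := Fintype.card_pos_iff.1 hpos
    have hzero : relMatrix (pwRel I P' s i) = 0 := by
      ext x y
      exact relMatrix_of_not_rel (hempty x y)
    have h1 := congrFun (congrFun (ones_mul_relMatrix_pwRel hs1 h h' hd i) x) x
    rw [hzero, Matrix.mul_zero, Matrix.smul_apply, Matrix.of_apply, Matrix.zero_apply,
      smul_eq_mul, mul_one] at h1
    have hne : pwP (s : ℝ) 0 i ≠ 0 := by
      fin_cases i <;> simp [pwP, e0, e1, e2, e4]
    exact hne h1.symm
  · rw [hcard]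
    exact pwP_mul_pwQ _
  · intro i
    fin_cases i <;> rfl
  · intro r
    fin_cases r <;> rfl
  · intro i
    fin_cases i <;> simp [pwQ, e0, e1, e2, e3, e4]

end PenttilaWilliford

theorem theorem8p1 {P L : Type*} [Fintype P] [DecidableEq P]
    (I : P → L → Prop) (P' : Set P) [DecidablePred (· ∈ P')] (L' : Set L) (s : ℕ) (hs : 2 < s)
    (hQ : IsGQ I s (s ^ 2)) (hQ' : IsSubGQ I P' L' s s) (hd : IsDoublySubtended I P') :
    IsAssociationScheme (pwRel I P' s) ∧
    (∃ E : Fin 5 → Matrix {p : P // p ∉ P'} {p : P // p ∉ P'} ℝ,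
      IsCometricOrdering (pwRel I P' s) E) ∧
    ∀ E : Fin 5 → Matrix {p : P // p ∉ P'} {p : P // p ∉ P'} ℝ,
      IsCometricOrdering (pwRel I P' s) E →
      ∀ θ : Set {p : P // p ∉ P'}, θ ≠ ∅ → θ ≠ Set.univ →
        (IsIntriguing E 1 θ ∨ IsIntriguing E 3 θ ∨ IsTDesign E {2, 4} θ) →
        (θ.ncard : ℝ) = (1 / 2) * Fintype.card {p : P // p ∉ P'} := by
  have H := hasEigenmatrices_pwRel hs hQ hQ' hd
  have hcard := card_external hQ hQ'
  refine ⟨H.isAssociationScheme, ⟨_, H.isIdempotentOrdering, _, H.isKrein, ?_, ?_⟩, ?_⟩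
  · exact kreinParam_pw_eq_zero _ _
  · exact kreinParam_pw_ne_zero H.card_ne_zero (by exact_mod_cast hs) hcard
  · intro E hE θ hne hnu hθ
    obtain ⟨x₀⟩ := Fintype.card_pos_iff.1 H.card_pos
    exact hE.ncard_eq_half hd.mate_mate (k := 4) (fun _ _ => pwRel_four_iff hd) x₀
      (hd.mate_ne x₀) hne hnu hθ
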